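/- Let $X=\{0,1\}^d$ and $Z=X\times\{\pm1\}$. A $\delta$-local randomizer is a randomized map $R:Z\to W$, with $W$ discrete, such that $\Pr[R(z_1)=w]\le e^{\delta}\Pr[R(z_2)=w]$ for all $z_1,z_2\in Z$, $w\in W$. A (randomized) algorithm is $\varepsilon$-LDP if it accesses its data set $S=(z_1,\dots,z_n)\in Z^n$ only by queries $(i,R)$, answered by a fresh random value $R(z_i)$, where in every execution and for every $i$ the randomizers $R_1,\dots,R_k$ applied to $z_i$ are $\varepsilon_j$-local randomizers with $\varepsilon_j\ge 0$ and $\sum_j\varepsilon_j\le\varepsilon$. A query is label-independent if its randomizer $R(x,y)$ does not depend on $y$. The algorithm is label-non-adaptive if, once its internal random bits are fixed, there is a set $J\subseteq\{1,\dots,n\}$ of samples such that the queries to samples in $J$ are determined before any response is seen, and all queries to samples outside $J$ (which may depend on all previous responses) are label-independent. If each sample is queried at most once, this says exactly that the label-dependent queries are determined before any response is seen. The algorithm learns a class $C$ of functions $f:X\to\{\pm1\}$ with error less than $1/2$ and success probability at least $3/4$ from $n$ i.i.d. examples if for every distribution $D$ on $X$ and every $f\in C$, when run on $n$ examples $(x,f(x))$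 with $x$ drawn i.i.d. from $D$, it outputs $h:X\to\{\pm1\}$ with $\Pr_{x\sim D}[f(x)\ne h(x)]<1/2$ with probability at least $3/4$. Then there is an absolute constant $c>0$ such that for all $d,n\ge 0$ and $\varepsilon\ge 0$: 1. every label-non-adaptive $\varepsilon$-LDP algorithm that learns the class of linear separators over $\{0,1\}^d$ (the functions that are $+1$ exactly where $\langle w,x\rangle\ge\theta$, with $w\in\mathbb R^d$, $\theta\in\mathbb R$) with error less than $1/2$ and success probability at least $3/4$ from $n$ i.i.d. examples has $n\ge 2^{c d}/e^{\varepsilon}$; 2. every label-non-adaptive $\varepsilon$-LDP algorithm that learns the class of decision lists over $\{0,1\}^d$ (functions of the form "if $\ell_1$ then $v_1$, else if $\ell_2$ then $v_2$, …, else $b$" with literals $\ell_j$ and $v_j,b\in\{\pm1\}$) with error less than $1/2$ and success probability at least $3/4$ from $n$ i.i.d. examples has $n\ge 2^{c d^{1/3}}/e^{\varepsilon}$. -/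

import Mathlib

open scoped ENNReal

/-- The Boolean cube `{0,1}^d`. -/
abbrev Cube (d : ℕ) : Type := Fin d → Bool

/-- Boolean functions on the cube; the value `true` stands for `+1` and `false` for `-1`. -/
abbrev BoolFun (d : ℕ) : Type := Cube d → Bool

/-- Labelled examples `(x, y)`. -/
abbrev Example (d : ℕ) : Type := Cube d × Bool

/-- Linear separators (halfspaces) over `{0,1}^d`: `f x = +1` iff `⟨w, x⟩ ≥ θ`. -/
def linearSeparators (d : ℕ) : Set (BoolFun d) :=
  {f | ∃ (w : Fin d → ℝ) (θ : ℝ), ∀ x, f x = true ↔ θ ≤ ∑ i, w i * (if x i then 1 else 0)}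

/-- Value at `x` of the decision list "if `ℓ₁` then `v₁`, else if `ℓ₂` then `v₂`, …, else `b`".
The item `((i, s), v)` has as its condition the literal "`x i = s`", and `v` as its value. -/
def evalDecisionList {d : ℕ} : List ((Fin d × Bool) × Bool) → Bool → BoolFun d
  | [], b, _ => b
  | ((i, s), v) :: L, b, x => if x i = s then v else evalDecisionList L b x

/-- Decision lists over `{0,1}^d`. -/
def decisionLists (d : ℕ) : Set (BoolFun d) :=
  {f | ∃ (L : List ((Fin d × Bool) × Bool)) (b : Bool), f = evalDecisionList L b}

/-- `R` is an `ε`-local randomizer: `Pr[R z₁ = w] ≤ e^ε Pr[R z₂ = w]`. -/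
def IsLocalRandomizer {Z W : Type*} (ε : ℝ) (R : Z → PMF W) : Prop :=
  ∀ z₁ z₂ w, R z₁ w ≤ ENNReal.ofReal (Real.exp ε) * R z₂ w

/-- The randomizer `R` depends only on the point and not on its label. -/
def LabelIndependent {d : ℕ} {W : Type*} (R : Example d → PMF W) : Prop :=
  ∀ x y y', R (x, y) = R (x, y')

/-- An interactive algorithm, with its internal random bits fixed, that accesses a data set
`S : Fin n → Z` only through the local randomizer oracle. It either halts with an output, or asks
the oracle to apply a randomizer `R` to the `i`-th sample, receives the response `w : W`, and
continues in a way that may depend on `w`. -/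
inductive Protocol (n : ℕ) (Z W H : Type*) where
  | output (h : H) : Protocol n Z W H
  | query (i : Fin n) (R : Z → PMF W) (next : W → Protocol n Z W H) : Protocol n Z W H

namespace Protocol

variable {n : ℕ} {Z W H : Type*}

/-- The law of the output on the data set `S` (each oracle call uses fresh randomness). -/
noncomputable def run (S : Fin n → Z) : Protocol n Z W H → PMF H
  | output h => PMF.pure h
  | query i R next => (R (S i)).bind fun w => run S (next w)

/-- In every execution, and for every `i`, the randomizers `R₁, …, R_k` that are applied to
sample `i` are `ε_j`-local randomizers for some `ε_j ≥ 0` with `ε₁ + ⋯ + ε_k ≤ b i`: each query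
uses up a part `δ` of the remaining budget of the sample. -/
def WithinBudget : Protocol n Z W H → (Fin n → ℝ) → Prop
  | output _, _ => True
  | query i R next, b => ∃ δ : ℝ, 0 ≤ δ ∧ δ ≤ b i ∧ IsLocalRandomizer δ R ∧
      ∀ w, WithinBudget (next w) (Function.update b i (b i - δ))

/-- The protocol is (compositionally) `ε`-LDP. -/
def IsLDP (ε : ℝ) (p : Protocol n Z W H) : Prop :=
  p.WithinBudget fun _ => ε

/-- Whatever the responses are, the queries to the samples in `J` are exactly those of the list
`L`, in this order, and all queries to the other samples are label-independent. -/
def FixedOn {d : ℕ} (J : Set (Fin n)) :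
    Protocol n (Example d) W H → List (Fin n × (Example d → PMF W)) → Prop
  | output _, L => L = []
  | query i R next, L =>
      (i ∈ J ∧ ∃ L', L = (i, R) :: L' ∧ ∀ w, FixedOn J (next w) L') ∨
      (i ∉ J ∧ LabelIndependent R ∧ ∀ w, FixedOn J (next w) L)

/-- The protocol is label-non-adaptive: every sample that receives a label-dependent query
belongs to a set `J` of samples all queries to which are fixed before any response is seen;
the queries to the other samples may depend on all previous responses, but are
label-independent. (For protocols that query each sample at most once, this says that the
label-dependent queries are fixed before any response is seen.) -/
def LabelNonAdaptive {d : ℕ} (p : Protocol n (Example d) W H) : Prop :=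
  ∃ (J : Set (Fin n)) (L : List (Fin n × (Example d → PMF W))), p.FixedOn J L

end Protocol

/-- The error `Pr_{x ∼ D}[f x ≠ h x]`. -/
noncomputable def learningError {d : ℕ} (D : PMF (Cube d)) (f h : BoolFun d) : ℝ≥0∞ :=
  D.toOuterMeasure {x | f x ≠ h x}

open MeasureTheory in
/-- The probability that the randomized algorithm `A`, whose internal random bits `ω` have law
`μ`, outputs a hypothesis with error less than `1/2`, when it is run on `n` examples `(x, f x)`
with `x` drawn i.i.d. from `D`. -/
noncomputable def successProb {d n : ℕ} {Ω W : Type*} [MeasurableSpace Ω] (μ : Measure Ω)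
    (A : Ω → Protocol n (Example d) W (BoolFun d)) (D : PMF (Cube d)) (f : BoolFun d) : ℝ≥0∞ :=
  ∫⁻ ω, ∑ x : Fin n → Cube d, (∏ i, D (x i)) *
    ((A ω).run fun i => (x i, f (x i))).toOuterMeasure {h | learningError D f h < 1 / 2} ∂μ

open MeasureTheory in
/-- `A` is a (randomized) label-non-adaptive `ε`-LDP algorithm, with internal randomness in
`(Ω, μ)` and oracle responses in `W`, that distribution-independently PAC learns the class `C`
from `n` i.i.d. examples, with error less than `1/2` and success probability at least `3/4`. -/
def LearnsLabelNonAdaptively {d n : ℕ} {Ω W : Type*} [MeasurableSpace Ω] (ε : ℝ)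
    (C : Set (BoolFun d)) (μ : Measure Ω)
    (A : Ω → Protocol n (Example d) W (BoolFun d)) : Prop :=
  (∀ ω, (A ω).IsLDP ε) ∧ (∀ ω, (A ω).LabelNonAdaptive) ∧
    ∀ (D : PMF (Cube d)), ∀ f ∈ C, 3 / 4 ≤ successProb μ A D f

/-!
Label-non-adaptive learners are weak because a randomizer that is fixed in advance has to be
correlated with every function of the class under every distribution.

*From algorithms to correlations.* Fix the internal random bits. For a sample in `J`, the whole list
of randomizers applied to it is fixed, so that it acts as one `ε`-local randomizer `T` on the
sample; a sample outside `J` never reveals its label. Run the algorithm on labels `f` and on labels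
`-f`, with the same distribution `D` of points. No hypothesis has error below `1/2` for both, so the
two output laws differ by at least `1/2`, while flipping the labels sample by sample
(`exists_randomizers_eventProb_le`) changes the law by at most the sum over the samples of the
`labelBias` of `T`, an average of terms `|E_D f g|`, where `g` is the difference of the response
probabilities of `T` on the two labels. Since `T` does not depend on `(D, f)`, one can average over
a family of pairs `(D, f)`, written as a kernel `K` with rows `D f`. If `∑ₐ |∑ₓ K a x * g x| ≤ δ`
for all `|g| ≤ 1`, then `1/2 ≤ n (e^ε - 1) δ` (`half_le_of_learnsLabelNonAdaptively`). It remains to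
exhibit kernels of small discrepancy `δ`.

*Linear separators* (`exists_linearSeparators_kernel`). Let `w` be uniform in `{0, …, M - 1}^d`, let
`y` be a uniform point, and let `θ` be `⟨w, y⟩` or `⟨w, y⟩ + 1`, so that `y` is barely on one or the
other side of the threshold. By the Cauchy–Schwarz inequality, `δ^2` is controlled by the
differences `Pr[⟨w, y - y'⟩ = 0] - Pr[⟨w, y - y'⟩ = ±1]`, which are at most `M^(-2)` if `y` and `y'`
differ in at least two coordinates. With `M` about `2^(d/2)` this gives `δ = 2^(-Ω(d))`.

*Decision lists* (`exists_decisionLists_kernel`). Consider `N` blocks of `O(N^2)` variables, and the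
decision list whose value is determined by the first nonzero block and alternates between blocks.
On one block there is a signed measure `ψ` that annihilates all polynomials of degree at most `N`,
has value `1` at the origin, and has positive mass at most `1/2` elsewhere (`exists_blockKernel`);
it is a combination of product measures whose coefficients come from a finite difference of order
`2N`. Using `ψ` block by block to correct the part of the wrong sign gives a kernel with the signs
of the decision list, whose Walsh coefficients of degree at most `N` are at most `2^(-N)`
(`sum_good_add_bad_mul_walsh`, `sum_abs_badKernel_le`). Finally every variable is replaced by one of
two copies, chosen at random; this multiplies the coefficients at sets `S` by `2^(-|S|/2)`
(`sum_abs_liftedKernel_mul_le`), so that those of high degree are small as well. With `d` of order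
`N^3` this gives `δ = 2^(-Ω(d^(1/3)))`.
-/

/-! ### Privacy: the response law of a single sample -/

namespace Protocol

variable {n : ℕ} {Z W H : Type*}

/-- The law of the list of responses when the randomizers of a list are applied, in this order and
with fresh randomness, to the same sample `z`. -/
noncomputable def responses : List (Z → PMF W) → Z → PMF (List W)
  | [], _ => PMF.pure []
  | R :: L, z => (R z).bind fun w => (responses L z).bind fun u => PMF.pure (w :: u)

/-- The randomizers that a list of queries applies to the sample `i`, in their order. -/
def queriesTo (i : Fin n) (L : List (Fin n × (Z → PMF W))) : List (Z → PMF W) :=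
  L.filterMap fun q => if q.1 = i then some q.2 else none

lemma responses_cons_nil (R : Z → PMF W) (L : List (Z → PMF W)) (z : Z) :
    responses (R :: L) z [] = 0 := by
  simp [responses, PMF.bind_apply]

lemma responses_cons_cons (R : Z → PMF W) (L : List (Z → PMF W)) (z : Z) (w : W) (u : List W) :
    responses (R :: L) z (w :: u) = R z w * responses L z u := by
  classical
  simp only [responses, PMF.bind_apply, PMF.pure_apply, List.cons.injEq]
  rw [tsum_eq_single w]
  · congr 1
    rw [tsum_eq_single u]
    · simp
    · intro u' hu'
      simp [hu'.symm]
  · intro w' hw'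
    simp [hw'.symm]

/-- Composition of local randomizers: the budgets of the rounds add up. -/
lemma IsLocalRandomizer.responses_cons {R : Z → PMF W} {L : List (Z → PMF W)} {δ δ' : ℝ}
    (hR : IsLocalRandomizer δ R) (hL : IsLocalRandomizer δ' (responses L)) :
    IsLocalRandomizer (δ + δ') (responses (R :: L)) := by
  intro z₁ z₂ u
  cases u with
  | nil => simp [responses_cons_nil]
  | cons w u =>
    rw [responses_cons_cons, responses_cons_cons, Real.exp_add,
      ENNReal.ofReal_mul (Real.exp_pos _).le]
    calc _ ≤ (ENNReal.ofReal (Real.exp δ) * R z₂ w)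
          * (ENNReal.ofReal (Real.exp δ') * responses L z₂ u) :=
          mul_le_mul' (hR z₁ z₂ w) (hL z₁ z₂ u)
      _ = _ := by ring

/-- The responses of a sample in `J` are, jointly, as private as the budget of the sample says. -/
lemma FixedOn.isLocalRandomizer_responses {d : ℕ} {J : Set (Fin n)} {i : Fin n} (hi : i ∈ J)
    {p : Protocol n (Example d) W H} {L : List (Fin n × (Example d → PMF W))} {b : Fin n → ℝ}
    (hp : p.FixedOn J L) (hb : p.WithinBudget b) (hbi : 0 ≤ b i) :
    IsLocalRandomizer (b i) (responses (queriesTo i L)) := by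
  induction p generalizing L b with
  | output h =>
    obtain rfl : L = [] := hp
    intro z₁ z₂ u
    simp only [queriesTo, List.filterMap_nil, responses]
    exact le_mul_of_one_le_left (zero_le) (by simpa using hbi)
  | query k R next ih =>
    obtain ⟨δ, hδ, hδb, hR, hnext⟩ := hb
    obtain ⟨w, -⟩ := (R (fun _ => false, false)).support_nonempty
    rcases hp with ⟨hk, L', rfl, hL'⟩ | ⟨hk, -, hL⟩
    · by_cases hki : k = i
      · subst hki
        have := ih w (hL' w) (hnext w) (by simpa using hδb)
        have h2 := IsLocalRandomizer.responses_cons hR this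
        simpa [queriesTo] using h2
      · have := ih w (hL' w) (hnext w) (by
          rw [Function.update_of_ne (Ne.symm hki)]; exact hbi)
        rw [Function.update_of_ne (Ne.symm hki)] at this
        simpa [queriesTo, hki] using this
    · have hki : i ≠ k := by rintro rfl; exact hk hi
      have := ih w (hL w) (hnext w) (by rw [Function.update_of_ne hki]; exact hbi)
      rwa [Function.update_of_ne hki] at this

/-- With all other samples fixed, a sample in `J` influences the output only through the responses
to its own fixed list of queries. -/
lemma FixedOn.exists_run_update_eq_bind {d : ℕ} {J : Set (Fin n)} {i : Fin n} (hi : i ∈ J)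
    {p : Protocol n (Example d) W H} {L : List (Fin n × (Example d → PMF W))}
    (hp : p.FixedOn J L) (S : Fin n → Example d) :
    ∃ q : List W → PMF H, ∀ z,
      p.run (Function.update S i z) = (responses (queriesTo i L) z).bind q := by
  induction p generalizing L with
  | output h =>
    exact ⟨fun _ => PMF.pure h, fun z => by simp [run, PMF.bind_const]⟩
  | query k R next ih =>
    rcases hp with ⟨hk, L', rfl, hL'⟩ | ⟨hk, -, hL⟩
    · choose q hq using fun w => ih w (hL' w)
      by_cases hki : k = i
      · subst hki
        obtain ⟨w₀, -⟩ := (R (fun _ => false, false)).support_nonempty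
        -- The first response is the head of `u`; the empty list has probability `0`.
        refine ⟨fun u => q (u.headD w₀) u.tail, fun z => ?_⟩
        simp only [run, Function.update_self, hq, queriesTo, List.filterMap_cons, if_true,
          responses, PMF.bind_bind, PMF.pure_bind, List.headD_cons, List.tail_cons]
      · refine ⟨fun u => (R (S k)).bind fun w => q w u, fun z => ?_⟩
        rw [PMF.bind_comm]
        simp only [run, Function.update_of_ne hki, hq, queriesTo, List.filterMap_cons, if_neg hki]
    · have hki : k ≠ i := by rintro rfl; exact hk hi
      choose q hq using fun w => ih w (hL w)
      refine ⟨fun u => (R (S k)).bind fun w => q w u, fun z => ?_⟩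
      rw [PMF.bind_comm]
      simp only [run, Function.update_of_ne hki, hq]

/-- The labels of the samples outside `J` have no influence on the output. -/
lemma FixedOn.run_update_label {d : ℕ} {J : Set (Fin n)} {i : Fin n} (hi : i ∉ J)
    {p : Protocol n (Example d) W H} {L : List (Fin n × (Example d → PMF W))}
    (hp : p.FixedOn J L) (S : Fin n → Example d) (x : Cube d) (y y' : Bool) :
    p.run (Function.update S i (x, y)) = p.run (Function.update S i (x, y')) := by
  induction p generalizing L with
  | output h => rfl
  | query k R next ih =>
    rcases hp with ⟨hk, L', rfl, hL'⟩ | ⟨hk, hR, hL⟩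
    · have hki : k ≠ i := by rintro rfl; exact hi hk
      simp only [run, Function.update_of_ne hki, fun w => ih w (hL' w)]
    · by_cases hki : k = i
      · subst hki
        simp only [run, Function.update_self, fun w => ih w (hL w), hR x y y']
      · simp only [run, Function.update_of_ne hki, fun w => ih w (hL w)]

end Protocol

/-! ### Flipping the labels of the samples one at a time -/

/-- The `L¹` distance between the laws of the response of `T` to an example labelled by `f` and to
an example labelled by the negation of `f`, the point having law `D`. -/
noncomputable def labelBias {d : ℕ} {U : Type*} (T : Example d → PMF U) (D : PMF (Cube d))
    (f : BoolFun d) : ℝ≥0∞ :=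
  ∑' u, ENNReal.ofReal |∑ x, (D x).toReal * ((T (x, f x) u).toReal - (T (x, !f x) u).toReal)|

lemma ENNReal.le_add_ofReal_abs_sub {a b : ℝ≥0∞} (ha : a ≠ ∞) (hb : b ≠ ∞) :
    a ≤ b + ENNReal.ofReal |a.toReal - b.toReal| := by
  rw [← ENNReal.ofReal_toReal ha, ← ENNReal.ofReal_toReal hb,
    ← ENNReal.ofReal_add ENNReal.toReal_nonneg (abs_nonneg _)]
  apply ENNReal.ofReal_le_ofReal
  rw [ENNReal.toReal_ofReal ENNReal.toReal_nonneg, ENNReal.toReal_ofReal ENNReal.toReal_nonneg]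
  linarith [le_abs_self (a.toReal - b.toReal)]

lemma sum_bind_toOuterMeasure_le_add_labelBias {d : ℕ} {U H : Type*} (T : Example d → PMF U)
    (q : U → PMF H) (E : Set H) (D : PMF (Cube d)) (f : BoolFun d) :
    ∑ x, D x * ((T (x, f x)).bind q).toOuterMeasure E ≤
      ∑ x, D x * ((T (x, !f x)).bind q).toOuterMeasure E + labelBias T D f := by
  have key : ∀ g : BoolFun d, ∑ x, D x * ((T (x, g x)).bind q).toOuterMeasure E
      = ∑' u, (∑ x, D x * T (x, g x) u) * (q u).toOuterMeasure E := by
    intro g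
    simp only [PMF.toOuterMeasure_bind_apply, ← ENNReal.tsum_mul_left, Finset.sum_mul]
    rw [Summable.tsum_finsetSum (fun _ _ => ENNReal.summable)]
    simp only [mul_assoc]
  have hfin : ∀ (g : BoolFun d) u, ∀ x ∈ Finset.univ, D x * T (x, g x) u ≠ ∞ := fun g u x _ =>
    ENNReal.mul_ne_top (D.apply_ne_top x) ((T (x, g x)).apply_ne_top u)
  have hreal : ∀ (g : BoolFun d) u, (∑ x, D x * T (x, g x) u).toReal
      = ∑ x, (D x).toReal * (T (x, g x) u).toReal := by
    intro g u
    rw [ENNReal.toReal_sum (hfin g u)]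
    simp only [ENNReal.toReal_mul]
  rw [key f, key (fun x => !f x), labelBias, ← ENNReal.tsum_add]
  refine ENNReal.tsum_le_tsum fun u => ?_
  have hq : (q u).toOuterMeasure E ≤ 1 := by
    rw [PMF.toOuterMeasure_apply, ← (q u).tsum_coe]
    exact ENNReal.tsum_le_tsum fun h => Set.indicator_le_self _ _ _
  have h := ENNReal.le_add_ofReal_abs_sub (a := ∑ x, D x * T (x, f x) u)
    (b := ∑ x, D x * T (x, !f x) u) (ENNReal.sum_ne_top.2 (hfin f u))
    (ENNReal.sum_ne_top.2 (hfin (fun x => !f x) u))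
  rw [hreal f, hreal (fun x => !f x), ← Finset.sum_sub_distrib] at h
  simp only [← mul_sub] at h
  calc _ ≤ (∑ x, D x * T (x, !f x) u + ENNReal.ofReal |∑ x, (D x).toReal *
          ((T (x, f x) u).toReal - (T (x, !f x) u).toReal)|) * (q u).toOuterMeasure E := by gcongr
    _ ≤ _ := by
      rw [add_mul]
      gcongr
      exact mul_le_of_le_one_right' hq

/-- The probability of the event `E` for the output of `p` on examples with i.i.d. points of law
`D`, when the `i`-th sample is labelled by `g i`. -/
noncomputable def eventProb {d n : ℕ} {W H : Type*} (p : Protocol n (Example d) W H)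
    (D : PMF (Cube d)) (g : Fin n → BoolFun d) (E : Set H) : ℝ≥0∞ :=
  ∑ x : Fin n → Cube d, (∏ i, D (x i)) * (p.run fun i => (x i, g i (x i))).toOuterMeasure E

/-- Resampling the `i`-th coordinate does not change an average over i.i.d. samples. -/
lemma sum_prod_mul_eq_sum_update {X : Type*} [Fintype X] {n : ℕ} (D : X → ℝ≥0∞)
    (hD : ∑ x, D x = 1) (i : Fin n) (F : (Fin n → X) → ℝ≥0∞) :
    ∑ x : Fin n → X, (∏ j, D (x j)) * F x
      = ∑ x : Fin n → X, (∏ j, D (x j)) * ∑ y, D y * F (Function.update x i y) := by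
  classical
  rw [← (Equiv.funSplitAt i X).symm.sum_comp, ← (Equiv.funSplitAt i X).symm.sum_comp,
    Fintype.sum_prod_type, Fintype.sum_prod_type, Finset.sum_comm, Finset.sum_comm (γ := X)]
  refine Finset.sum_congr rfl fun r _ => ?_
  have hprod : ∀ a : X, ∏ j, D ((Equiv.funSplitAt i X).symm (a, r) j) = D a * ∏ j, D (r j) := by
    intro a
    rw [Fintype.prod_eq_mul_prod_subtype_ne _ i]
    congr 1
    · simp
    · refine Finset.prod_congr rfl fun j _ => ?_
      simp [j.2]
  have hupd : ∀ a y : X, Function.update ((Equiv.funSplitAt i X).symm (a, r)) i y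
      = (Equiv.funSplitAt i X).symm (y, r) := by
    intro a y
    ext j
    by_cases hj : j = i
    · subst hj; simp
    · simp [hj]
  simp only [hprod, hupd]
  rw [← Finset.sum_mul, ← Finset.sum_mul, hD, one_mul, Finset.mul_sum]
  exact Finset.sum_congr rfl fun a _ => by ring

lemma eventProb_eq_sum_update {d n : ℕ} {W H : Type*} (p : Protocol n (Example d) W H)
    (D : PMF (Cube d)) (g : Fin n → BoolFun d) (E : Set H) (i : Fin n) :
    eventProb p D g E = ∑ x : Fin n → Cube d, (∏ j, D (x j)) * ∑ y, D y *
      (p.run (Function.update (fun j => (x j, g j (x j))) i (y, g i y))).toOuterMeasure E := by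
  rw [eventProb, sum_prod_mul_eq_sum_update (fun x => D x) (by
    rw [← tsum_fintype (L := .unconditional _)]; exact D.tsum_coe) i]
  refine Finset.sum_congr rfl fun x _ => ?_
  congr 1
  refine Finset.sum_congr rfl fun y _ => ?_
  have : (fun j => (Function.update x i y j, g j (Function.update x i y j)))
      = Function.update (fun j => (x j, g j (x j))) i (y, g i y) := by
    ext j : 1
    by_cases hj : j = i
    · subst hj; simp
    · simp [hj]
  rw [this]

lemma sum_prod_pmf_eq_one {X : Type*} [Fintype X] {n : ℕ} (D : PMF X) :
    ∑ x : Fin n → X, ∏ j, D (x j) = 1 := by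
  classical
  rw [← Fintype.piFinset_univ, ← Finset.prod_univ_sum]
  have : ∑ x, D x = 1 := by rw [← tsum_fintype (L := .unconditional _)]; exact D.tsum_coe
  simp [this]

open Protocol in
/-- The sample-by-sample hybrid argument. The randomizers `T i` depend on the protocol only, and
not on the distribution or the function to be learned. -/
theorem exists_randomizers_eventProb_le {d n : ℕ} {W H : Type*} {ε : ℝ} (hε : 0 ≤ ε)
    {p : Protocol n (Example d) W H} (hp : p.IsLDP ε) (hna : p.LabelNonAdaptive) :
    ∃ T : Fin n → Example d → PMF (List W), (∀ i, IsLocalRandomizer ε (T i)) ∧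
      ∀ (D : PMF (Cube d)) (f : BoolFun d) (E : Set H),
        eventProb p D (fun _ => f) E ≤
          eventProb p D (fun _ x => !f x) E + ∑ i, labelBias (T i) D f := by
  classical
  obtain ⟨J, L, hL⟩ := hna
  refine ⟨fun i => if i ∈ J then responses (queriesTo i L) else fun _ => PMF.pure [],
    fun i => ?_, fun D f E => ?_⟩
  · dsimp only
    split_ifs with hi
    · exact hL.isLocalRandomizer_responses hi hp hε
    · intro z₁ z₂ u
      exact le_mul_of_one_le_left zero_le (by simpa using hε)
  set T : Fin n → Example d → PMF (List W) :=
    fun i => if i ∈ J then responses (queriesTo i L) else fun _ => PMF.pure [] with hT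
  let g : Finset (Fin n) → Fin n → BoolFun d := fun A i x => if i ∈ A then !f x else f x
  have hybrid : ∀ A : Finset (Fin n), eventProb p D (fun _ => f) E ≤
      eventProb p D (g A) E + ∑ i ∈ A, labelBias (T i) D f := by
    intro A
    induction A using Finset.induction_on with
    | empty => simp [g]
    | insert i A hiA ih =>
      rw [Finset.sum_insert hiA, ← add_assoc]
      refine ih.trans (add_le_add_left ?_ _)
      -- Only the label of the sample `i` changes; it is compared with all other samples fixed.
      rw [eventProb_eq_sum_update p D (g A) E i, eventProb_eq_sum_update p D (g (insert i A)) E i,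
        ← one_mul (labelBias (T i) D f), ← sum_prod_pmf_eq_one (n := n) D, Finset.sum_mul,
        ← Finset.sum_add_distrib]
      refine Finset.sum_le_sum fun x _ => ?_
      rw [← mul_add]
      gcongr
      have hrest : ∀ z, Function.update (fun j => (x j, g (insert i A) j (x j))) i z
          = Function.update (fun j => (x j, g A j (x j))) i z := by
        intro z
        ext j : 1
        by_cases hj : j = i
        · subst hj; simp
        · simp [hj, g]
      have h1 : ∀ y, g A i y = f y := fun y => by simp [g, hiA]
      have h2 : ∀ y, g (insert i A) i y = !f y := fun y => by simp [g]
      simp only [hrest, h1, h2]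
      by_cases hi : i ∈ J
      · obtain ⟨q, hq⟩ := hL.exists_run_update_eq_bind hi (fun j => (x j, g A j (x j)))
        simp only [hq, hT, hi, if_true]
        exact sum_bind_toOuterMeasure_le_add_labelBias _ q E D f
      · refine le_add_right (le_of_eq ?_)
        refine Finset.sum_congr rfl fun y _ => ?_
        rw [hL.run_update_label hi _ y (f y) (!f y)]
  simpa [g] using hybrid Finset.univ

/-! ### From discrepancy to sample size -/

/-- The value `±1` that a Boolean stands for. -/
def boolSign (b : Bool) : ℝ := if b then 1 else -1

/-- Averaged over a family of small discrepancy, an `ε`-local randomizer reveals little about the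
labels. -/
lemma sum_mul_labelBias_le {d : ℕ} {α U : Type*} [Fintype α] {ε δ : ℝ} (hε : 0 ≤ ε)
    {T : Example d → PMF U} (hT : IsLocalRandomizer ε T) {P : α → ℝ} (hP : ∀ a, 0 ≤ P a)
    (D : α → PMF (Cube d)) (f : α → BoolFun d)
    (hdisc : ∀ g : Cube d → ℝ, (∀ x, |g x| ≤ 1) →
      ∑ a, P a * |∑ x, (D a x).toReal * (boolSign (f a x) * g x)| ≤ δ) :
    ∑ a, ENNReal.ofReal (P a) * labelBias T (D a) (f a) ≤
      ENNReal.ofReal ((Real.exp ε - 1) * δ) := by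
  have hδ : 0 ≤ δ := le_trans (by simp) (hdisc 0 (by simp))
  have hε1 : 0 ≤ Real.exp ε - 1 := by linarith [Real.one_le_exp hε]
  -- Normalizing the bias by the minimum `m u` over the inputs gives `|g u x| ≤ (e^ε - 1) m u` and
  -- `∑ m u ≤ 1` at once; any other reference law would cost a second factor `e^ε`.
  choose z hz using fun u => Finite.exists_min fun z => T z u
  let m : U → ℝ := fun u => (T (z u) u).toReal
  have hm0 : ∀ u, 0 ≤ m u := fun u => ENNReal.toReal_nonneg
  let g : U → Cube d → ℝ := fun u x => (T (x, true) u).toReal - (T (x, false) u).toReal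
  have hlow : ∀ u y, m u ≤ (T y u).toReal := fun u y =>
    ENNReal.toReal_mono ((T y).apply_ne_top u) (hz u y)
  have hupp : ∀ u y, (T y u).toReal ≤ Real.exp ε * m u := by
    intro u y
    have := ENNReal.toReal_mono (ENNReal.mul_ne_top ENNReal.ofReal_ne_top
      ((T (z u)).apply_ne_top u)) (hT y (z u) u)
    rwa [ENNReal.toReal_mul, ENNReal.toReal_ofReal (Real.exp_pos _).le] at this
  have hg : ∀ u x, |g u x| ≤ (Real.exp ε - 1) * m u := by
    intro u x
    rw [abs_le]
    constructor <;> simp only [g] <;>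
      linarith [hlow u (x, true), hlow u (x, false), hupp u (x, true), hupp u (x, false)]
  have hflip : ∀ a u, ∑ x, (D a x).toReal * ((T (x, f a x) u).toReal - (T (x, !f a x) u).toReal)
      = ∑ x, (D a x).toReal * (boolSign (f a x) * g u x) := by
    intro a u
    refine Finset.sum_congr rfl fun x _ => ?_
    cases f a x <;> simp [boolSign, g]
  have hu : ∀ u, ∑ a, P a * |∑ x, (D a x).toReal * (boolSign (f a x) * g u x)|
      ≤ (Real.exp ε - 1) * m u * δ := by
    intro u
    rcases (mul_nonneg hε1 (hm0 u)).eq_or_lt with h0 | h0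
    · have : ∀ x, g u x = 0 := fun x => by
        have := hg u x
        rw [← h0] at this
        simpa using this
      simp [this, ← h0]
    · have := hdisc (fun x => g u x / ((Real.exp ε - 1) * m u)) (fun x => by
        rw [abs_div, abs_of_pos h0, div_le_one h0]; exact hg u x)
      have hdiv : ∀ a, |∑ x, (D a x).toReal *
          (boolSign (f a x) * (g u x / ((Real.exp ε - 1) * m u)))|
          = |∑ x, (D a x).toReal * (boolSign (f a x) * g u x)| / ((Real.exp ε - 1) * m u) := by
        intro a
        rw [← abs_of_pos h0, ← abs_div, abs_of_pos h0, Finset.sum_div]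
        congr 1
        exact Finset.sum_congr rfl fun x _ => by ring
      simp only [hdiv] at this
      simp only [← mul_div_assoc, ← Finset.sum_div] at this
      rwa [div_le_iff₀ h0, mul_comm] at this
  have hmsum : ∑' u, ENNReal.ofReal (m u) ≤ 1 := by
    rw [← (T (fun _ => false, false)).tsum_coe]
    refine ENNReal.tsum_le_tsum fun u => ?_
    simp only [m]
    rw [ENNReal.ofReal_toReal ((T (z u)).apply_ne_top u)]
    exact hz u _
  simp only [labelBias, hflip, ← ENNReal.tsum_mul_left]
  rw [← Summable.tsum_finsetSum (fun _ _ => ENNReal.summable)]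
  calc _ ≤ ∑' u, ENNReal.ofReal ((Real.exp ε - 1) * δ) * ENNReal.ofReal (m u) := by
        refine ENNReal.tsum_le_tsum fun u => ?_
        simp only [← ENNReal.ofReal_mul (hP _)]
        rw [← ENNReal.ofReal_sum_of_nonneg (fun a _ => mul_nonneg (hP a) (abs_nonneg _)),
          ← ENNReal.ofReal_mul (mul_nonneg hε1 hδ)]
        exact ENNReal.ofReal_le_ofReal ((hu u).trans (le_of_eq (by ring)))
    _ ≤ ENNReal.ofReal ((Real.exp ε - 1) * δ) * 1 := by
        rw [ENNReal.tsum_mul_left]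
        gcongr
    _ = _ := mul_one _

lemma eventProb_add_le_one {d n : ℕ} {W : Type*} (p : Protocol n (Example d) W (BoolFun d))
    (D : PMF (Cube d)) (g : Fin n → BoolFun d) {E E' : Set (BoolFun d)} (h : Disjoint E E') :
    eventProb p D g E + eventProb p D g E' ≤ 1 := by
  rw [eventProb, eventProb, ← Finset.sum_add_distrib, ← sum_prod_pmf_eq_one (n := n) D]
  refine Finset.sum_le_sum fun x _ => ?_
  rw [← mul_add]
  refine mul_le_of_le_one_right' ?_
  set q := p.run fun i => (x i, g i (x i))
  rw [PMF.toOuterMeasure_apply, PMF.toOuterMeasure_apply, ← ENNReal.tsum_add, ← q.tsum_coe]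
  refine ENNReal.tsum_le_tsum fun h' => ?_
  by_cases h1 : h' ∈ E
  · simp [h1, Set.disjoint_left.1 h h1]
  · rw [Set.indicator_of_notMem h1, zero_add]
    exact Set.indicator_le_self _ _ _

/-- A hypothesis cannot have error below `1/2` both for `f` and for its negation. -/
lemma disjoint_learningError_lt_half {d : ℕ} (D : PMF (Cube d)) (f : BoolFun d) :
    Disjoint {h | learningError D f h < 1 / 2}
      {h | learningError D (fun x => !f x) h < 1 / 2} := by
  rw [Set.disjoint_left]
  intro h h1 h2
  have hsum : learningError D f h + learningError D (fun x => !f x) h = 1 := by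
    rw [learningError, learningError, PMF.toOuterMeasure_apply, PMF.toOuterMeasure_apply,
      ← ENNReal.tsum_add, ← D.tsum_coe]
    refine tsum_congr fun x => ?_
    by_cases hx : f x = h x
    · simp [Set.indicator, hx]
    · simp [Set.indicator, hx]
  have := ENNReal.add_lt_add (Set.mem_ofPred.1 h1) (Set.mem_ofPred.1 h2)
  rw [hsum, ENNReal.add_halves] at this
  exact lt_irrefl _ this

open MeasureTheory in
/-- Lower integrals are superadditive; no measurability is needed. -/
lemma sum_mul_lintegral_le {α Ω : Type*} [Fintype α] [MeasurableSpace Ω] (μ : Measure Ω)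
    (P : α → ℝ≥0∞) (F : α → Ω → ℝ≥0∞) :
    ∑ a, P a * ∫⁻ ω, F a ω ∂μ ≤ ∫⁻ ω, ∑ a, P a * F a ω ∂μ := by
  classical
  suffices h : ∀ s : Finset α, ∑ a ∈ s, P a * ∫⁻ ω, F a ω ∂μ ≤ ∫⁻ ω, ∑ a ∈ s, P a * F a ω ∂μ from
    h _
  intro s
  induction s using Finset.induction_on with
  | empty => simp
  | insert a s ha ih =>
    simp only [Finset.sum_insert ha]
    exact (add_le_add (lintegral_const_mul_le _ _) ih).trans (le_lintegral_add _ _)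

open MeasureTheory in
/-- If a class contains functions `f a` together with their negations, and a kernel `K` with the
signs of the `f a` has small discrepancy, then the class is hard for label-non-adaptive `ε`-LDP
algorithms. The absolute values of the rows of `K` are, up to scaling, the distributions on which
the learner is run. -/
theorem half_le_of_learnsLabelNonAdaptively {d n : ℕ} {α Ω W : Type*} [Fintype α]
    [MeasurableSpace Ω] {μ : Measure Ω} [IsProbabilityMeasure μ] {ε δ : ℝ} (hε : 0 ≤ ε)
    {C : Set (BoolFun d)} {A : Ω → Protocol n (Example d) W (BoolFun d)}
    (hA : LearnsLabelNonAdaptively ε C μ A) {f : α → BoolFun d} (hf : ∀ a, f a ∈ C)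
    (hf' : ∀ a, (fun x => !f a x) ∈ C) {K : α → Cube d → ℝ}
    (hsign : ∀ a x, 0 ≤ boolSign (f a x) * K a x) (hmass : 1 ≤ ∑ a, ∑ x, |K a x|)
    (hdisc : ∀ g : Cube d → ℝ, (∀ x, |g x| ≤ 1) → ∑ a, |∑ x, K a x * g x| ≤ δ) :
    1 / 2 ≤ n * ((Real.exp ε - 1) * δ) := by
  classical
  obtain ⟨hLDP, hna, hlearn⟩ := hA
  have hδ : 0 ≤ δ := le_trans (by simp) (hdisc 0 (by simp))
  have hε1 : 0 ≤ Real.exp ε - 1 := by linarith [Real.one_le_exp hε]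
  let P : α → ℝ := fun a => ∑ x, |K a x|
  have hP : ∀ a, 0 ≤ P a := fun a => Finset.sum_nonneg fun x _ => abs_nonneg _
  have hD : ∀ a, ∃ D : PMF (Cube d), ∀ x, P a * (D x).toReal = |K a x| := by
    intro a
    rcases (hP a).eq_or_lt with h0 | h0
    · refine ⟨PMF.pure fun _ => false, fun x => ?_⟩
      have := (Finset.sum_eq_zero_iff_of_nonneg fun x _ => abs_nonneg (K a x)).1 h0.symm x
        (Finset.mem_univ x)
      rw [this, ← h0, zero_mul]
    · refine ⟨PMF.ofFintype (fun x => ENNReal.ofReal (|K a x| / P a)) ?_, fun x => ?_⟩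
      · rw [← ENNReal.ofReal_sum_of_nonneg fun x _ => div_nonneg (abs_nonneg _) h0.le,
          ← Finset.sum_div, div_self h0.ne', ENNReal.ofReal_one]
      · rw [PMF.ofFintype_apply, ENNReal.toReal_ofReal (div_nonneg (abs_nonneg _) h0.le),
          mul_div_cancel₀ _ h0.ne']
  choose D hD using hD
  have habs : ∀ a x, boolSign (f a x) * |K a x| = K a x := by
    intro a x
    have := hsign a x
    cases hb : f a x <;> simp only [hb, boolSign] at this ⊢
    · simp only [Bool.false_eq_true, if_false] at this ⊢
      rw [abs_of_nonpos (by linarith)]; ring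
    · simp only [if_true] at this ⊢
      rw [abs_of_nonneg (by linarith)]; ring
  have hdisc' : ∀ g : Cube d → ℝ, (∀ x, |g x| ≤ 1) →
      ∑ a, P a * |∑ x, (D a x).toReal * (boolSign (f a x) * g x)| ≤ δ := by
    intro g hg
    refine le_trans (le_of_eq (Finset.sum_congr rfl fun a _ => ?_)) (hdisc g hg)
    rw [← abs_of_nonneg (hP a), ← abs_mul, Finset.mul_sum]
    congr 1
    refine Finset.sum_congr rfl fun x _ => ?_
    rw [← mul_assoc, hD a x, ← mul_assoc, mul_comm |K a x|, habs]
  let good : BoolFun d → α → Set (BoolFun d) := fun f a => {h | learningError (D a) f h < 1 / 2}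
  let F : α → Ω → ℝ≥0∞ := fun a ω =>
    eventProb (A ω) (D a) (fun _ => f a) (good (f a) a) +
      eventProb (A ω) (D a) (fun _ x => !f a x) (good (fun x => !f a x) a)
  have hpoint : ∀ ω, ∑ a, ENNReal.ofReal (P a) * F a ω ≤ ∑ a, ENNReal.ofReal (P a)
      + n * ENNReal.ofReal ((Real.exp ε - 1) * δ) := by
    intro ω
    obtain ⟨T, hT, hTle⟩ := exists_randomizers_eventProb_le hε (hLDP ω) (hna ω)
    have hF : ∀ a, F a ω ≤ 1 + ∑ i, labelBias (T i) (D a) (f a) := by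
      intro a
      calc F a ω ≤ (eventProb (A ω) (D a) (fun _ x => !f a x) (good (f a) a)
            + ∑ i, labelBias (T i) (D a) (f a))
            + eventProb (A ω) (D a) (fun _ x => !f a x) (good (fun x => !f a x) a) := by
            simp only [F]; gcongr; exact hTle _ _ _
        _ = (eventProb (A ω) (D a) (fun _ x => !f a x) (good (f a) a)
            + eventProb (A ω) (D a) (fun _ x => !f a x) (good (fun x => !f a x) a))
            + ∑ i, labelBias (T i) (D a) (f a) := by ring
        _ ≤ _ := by
            gcongr
            exact eventProb_add_le_one _ _ _ (disjoint_learningError_lt_half (D a) (f a))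
    calc _ ≤ ∑ a, ENNReal.ofReal (P a) * (1 + ∑ i, labelBias (T i) (D a) (f a)) := by
          gcongr with a; exact hF a
      _ = ∑ a, ENNReal.ofReal (P a)
          + ∑ i, ∑ a, ENNReal.ofReal (P a) * labelBias (T i) (D a) (f a) := by
          simp only [mul_add, mul_one, Finset.sum_add_distrib, Finset.mul_sum]
          rw [Finset.sum_comm (γ := α)]
      _ ≤ _ := by
          gcongr
          calc _ ≤ ∑ _i : Fin n, ENNReal.ofReal ((Real.exp ε - 1) * δ) :=
                Finset.sum_le_sum fun i _ => sum_mul_labelBias_le hε (hT i) hP D f hdisc'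
            _ = _ := by simp
  have hint : ∑ a, ENNReal.ofReal (P a) * (3 / 4 + 3 / 4) ≤ ∑ a, ENNReal.ofReal (P a)
      + n * ENNReal.ofReal ((Real.exp ε - 1) * δ) := by
    calc _ ≤ ∑ a, ENNReal.ofReal (P a) * ∫⁻ ω, F a ω ∂μ := by
          gcongr with a
          exact (add_le_add (hlearn (D a) (f a) (hf a)) (hlearn (D a) _ (hf' a))).trans
            (le_lintegral_add _ _)
      _ ≤ ∫⁻ ω, ∑ a, ENNReal.ofReal (P a) * F a ω ∂μ := sum_mul_lintegral_le μ _ F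
      _ ≤ ∫⁻ _, (∑ a, ENNReal.ofReal (P a)
          + n * ENNReal.ofReal ((Real.exp ε - 1) * δ)) ∂μ := lintegral_mono hpoint
      _ = _ := by simp
  have h34 : (3 / 4 + 3 / 4 : ℝ≥0∞) = ENNReal.ofReal (3 / 2) := by
    rw [show (3 / 4 : ℝ≥0∞) = ENNReal.ofReal (3 / 4) by
      rw [ENNReal.ofReal_div_of_pos (by norm_num)]; simp, ← ENNReal.ofReal_add] <;> norm_num
  rw [← Finset.sum_mul, h34, ← ENNReal.ofReal_sum_of_nonneg fun a _ => hP a,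
    ← ENNReal.ofReal_mul (Finset.sum_nonneg fun a _ => hP a), ← ENNReal.ofReal_natCast,
    ← ENNReal.ofReal_mul (Nat.cast_nonneg n),
    ← ENNReal.ofReal_add (Finset.sum_nonneg fun a _ => hP a)
      (mul_nonneg (Nat.cast_nonneg n) (mul_nonneg hε1 hδ)),
    ENNReal.ofReal_le_ofReal_iff (add_nonneg (Finset.sum_nonneg fun a _ => hP a)
      (mul_nonneg (Nat.cast_nonneg n) (mul_nonneg hε1 hδ)))] at hint
  linarith

/-! ### Linear separators with exponentially small discrepancy -/

/-- The value at `y` of the linear form with the natural weights `w i < M`. -/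
def cubeForm {d M : ℕ} (w : Fin d → Fin M) (y : Cube d) : ℕ :=
  ∑ i, if y i then (w i : ℕ) else 0

/-- The number of weight vectors `w` in `{0, …, M - 1}^d` with `⟨w, z⟩ = t`. -/
def formCount (M : ℕ) {d : ℕ} (z : Fin d → ℤ) (t : ℤ) : ℕ :=
  (Finset.univ.filter fun w : Fin d → Fin M => ∑ k, (w k : ℤ) * z k = t).card

lemma card_filter_coord_le {d M : ℕ} {z : Fin d → ℤ} {i j : Fin d} (hij : i ≠ j) (hj : z j ≠ 0)
    (c : Fin M) (t : ℤ) :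
    (Finset.univ.filter fun w : Fin d → Fin M =>
      w i = c ∧ ∑ k, (w k : ℤ) * z k = t).card ≤ M ^ (d - 2) := by
  classical
  have hcard : Fintype.card ({k // k ∉ ({i, j} : Finset (Fin d))} → Fin M) = M ^ (d - 2) := by
    rw [Fintype.card_fun, Fintype.card_fin, Fintype.card_subtype_compl, Fintype.card_fin,
      Fintype.card_coe, Finset.card_pair hij]
  rw [← hcard, ← Finset.card_univ]
  refine Finset.card_le_card_of_injOn (fun w k => w k) (fun _ _ => Finset.mem_coe.2
    (Finset.mem_univ _)) fun w hw w' hw' h => ?_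
  simp only [Finset.coe_filter, Finset.mem_univ, true_and, Set.mem_ofPred_eq] at hw hw'
  have hout : ∀ k, k ≠ j → w k = w' k := by
    intro k hkj
    by_cases hki : k = i
    · rw [hki, hw.1, hw'.1]
    · exact congrFun h ⟨k, by simp [hki, hkj]⟩
  have hsum : ∑ k, ((w k : ℤ) - (w' k : ℤ)) * z k = 0 := by
    simp only [sub_mul, Finset.sum_sub_distrib, hw.2, hw'.2, sub_self]
  rw [Finset.sum_eq_single j (fun k _ hk => by rw [hout k hk]; simp) (by simp)] at hsum
  funext k
  by_cases hk : k = j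
  · subst hk
    rcases mul_eq_zero.1 hsum with h0 | h0
    · exact Fin.ext (by omega)
    · exact absurd h0 hj
  · exact hout k hk

/-- Moving the `i`-th weight by `s` is possible unless that weight has the extreme value `c`; and
if `⟨w, z⟩` also involves another weight, few weight vectors have an extreme `i`-th entry. -/
lemma formCount_le_add {d M : ℕ} {z : Fin d → ℤ} {i j : Fin d} (hij : i ≠ j) (hj : z j ≠ 0)
    {c : Fin M} {φ : Fin M → Fin M} {s : ℤ} (hφ : ∀ a, a ≠ c → (φ a : ℤ) = a + s) (t : ℤ) :
    formCount M z t ≤ formCount M z (t + s * z i) + M ^ (d - 2) := by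
  classical
  rw [formCount, ← Finset.card_filter_add_card_filter_not (fun w : Fin d → Fin M => w i ≠ c)]
  refine add_le_add ?_ ?_
  · refine Finset.card_le_card_of_injOn (fun w => Function.update w i (φ (w i))) ?_ ?_
    · intro w hw
      simp only [Finset.coe_filter, Finset.mem_filter, Finset.mem_univ, true_and,
        Set.mem_ofPred_eq] at hw ⊢
      rw [← hw.1, Fintype.sum_eq_add_sum_compl i, Fintype.sum_eq_add_sum_compl i,
        Function.update_self, hφ _ hw.2]
      rw [Finset.sum_congr rfl fun k hk => by
        rw [Function.update_of_ne (by simpa using hk)]]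
      ring
    · intro w hw w' hw' h
      simp only [Finset.coe_filter, Finset.mem_filter, Finset.mem_univ, true_and,
        Set.mem_ofPred_eq] at hw hw'
      funext k
      have hk := congrFun h k
      by_cases hki : k = i
      · subst hki
        simp only [Function.update_self] at hk
        have h1 := hφ _ hw.2
        have h2 := hφ _ hw'.2
        rw [hk] at h1
        exact Fin.ext (by omega)
      · simpa [Function.update_of_ne hki] using hk
  · refine le_trans (Finset.card_le_card ?_) (card_filter_coord_le hij hj c t)
    intro w hw
    simp only [Finset.mem_filter, Finset.mem_univ, true_and, not_not] at hw ⊢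
    exact ⟨hw.2, hw.1⟩

lemma formCount_le_add_of_sign {d M : ℕ} (hM : 0 < M) {z : Fin d → ℤ} {i j : Fin d} (hij : i ≠ j)
    (hi : z i = 1 ∨ z i = -1) (hj : z j ≠ 0) (t : ℤ) {s : ℤ} (hs : s = 1 ∨ s = -1) :
    formCount M z t ≤ formCount M z (t + s) + M ^ (d - 2) := by
  have up := formCount_le_add (i := i) hij hj (c := ⟨M - 1, by omega⟩)
    (φ := fun a => if h : (a : ℕ) + 1 < M then ⟨a + 1, h⟩ else a) (s := 1) (fun a ha => by
      have : (a : ℕ) + 1 < M := by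
        have := a.2
        have : (a : ℕ) ≠ M - 1 := fun h => ha (Fin.ext h)
        omega
      simp [this]) t
  have down := formCount_le_add (i := i) hij hj (c := ⟨0, hM⟩)
    (φ := fun a => ⟨(a : ℕ) - 1, by omega⟩) (s := -1) (fun a ha => by
      have : (a : ℕ) ≠ 0 := fun h => ha (Fin.ext h)
      push_cast [Nat.one_le_iff_ne_zero.2 this]
      ring) t
  rcases hi with hi | hi <;> rcases hs with rfl | rfl <;> rw [hi] at up down <;>
    first | simpa using up | simpa using down

lemma abs_two_mul_formCount_sub_le {d M : ℕ} (hM : 0 < M) {z : Fin d → ℤ} {i j : Fin d}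
    (hij : i ≠ j) (hi : z i = 1 ∨ z i = -1) (hj : z j ≠ 0) :
    |2 * (formCount M z 0 : ℝ) - formCount M z 1 - formCount M z (-1)| ≤
      2 * ((M : ℝ) ^ d / M ^ 2) := by
  have hd : 2 ≤ d := by
    have := i.2; have := j.2
    have : (i : ℕ) ≠ j := fun h => hij (Fin.ext h)
    omega
  have hM' : (M : ℝ) ≠ 0 := by positivity
  have hpow : (M : ℝ) ^ d / M ^ 2 = (M : ℝ) ^ (d - 2) := by
    rw [div_eq_iff (by positivity), ← pow_add]; congr 1; omega
  rw [hpow]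
  have h (t s : ℤ) (hs : s = 1 ∨ s = -1) :
      (formCount M z t : ℝ) ≤ formCount M z (t + s) + (M : ℝ) ^ (d - 2) := by
    exact_mod_cast formCount_le_add_of_sign hM hij hi hj t hs
  have h1 := h 0 1 (by simp)
  have h2 := h 0 (-1) (by simp)
  have h3 := h 1 (-1) (by simp)
  have h4 := h (-1) 1 (by simp)
  norm_num at h1 h2 h3 h4
  rw [abs_le]
  constructor <;> linarith

lemma formCount_le_pow {d : ℕ} (M : ℕ) (z : Fin d → ℤ) (t : ℤ) : formCount M z t ≤ M ^ d := by
  refine (Finset.card_filter_le _ _).trans (le_of_eq ?_)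
  simp

lemma formCount_add_le_pow {d : ℕ} (M : ℕ) (z : Fin d → ℤ) {t t' : ℤ} (h : t ≠ t') :
    formCount M z t + formCount M z t' ≤ M ^ d := by
  classical
  rw [formCount, formCount, ← Finset.card_union_of_disjoint]
  · refine (Finset.card_le_univ _).trans (le_of_eq ?_)
    simp
  · rw [Finset.disjoint_filter]
    rintro w - rfl
    exact h

/-- The points that differ from `y` in at most one coordinate. -/
def nearPoints {d : ℕ} (y : Cube d) : Finset (Cube d) :=
  Finset.univ.image fun o : Option (Fin d) => o.elim y fun i => Function.update y i (!y i)

lemma card_nearPoints_le {d : ℕ} (y : Cube d) : (nearPoints y).card ≤ d + 1 := by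
  refine Finset.card_image_le.trans (le_of_eq ?_)
  simp

lemma exists_two_ne_of_notMem_nearPoints {d : ℕ} {y y' : Cube d} (h : y' ∉ nearPoints y) :
    ∃ i j, i ≠ j ∧ y i ≠ y' i ∧ y j ≠ y' j := by
  by_contra! hno
  apply h
  rw [nearPoints, Finset.mem_image]
  by_cases hyy : ∃ i, y i ≠ y' i
  · obtain ⟨i, hi⟩ := hyy
    refine ⟨some i, Finset.mem_univ _, ?_⟩
    funext k
    by_cases hk : k = i
    · subst hk
      cases h1 : y k <;> cases h2 : y' k <;> simp_all
    · simpa [Function.update_of_ne hk] using hno i k (Ne.symm hk) hi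
  · push Not at hyy
    exact ⟨none, Finset.mem_univ _, funext hyy⟩

/-- The difference of two cube points, as an integer vector. -/
def cubeDiff {d : ℕ} (y y' : Cube d) (i : Fin d) : ℤ :=
  (if y i then 1 else 0) - (if y' i then 1 else 0)

lemma sum_mul_cubeDiff {d M : ℕ} (w : Fin d → Fin M) (y y' : Cube d) :
    ∑ i, (w i : ℤ) * cubeDiff y y' i = (cubeForm w y : ℤ) - cubeForm w y' := by
  simp only [cubeForm, cubeDiff, mul_sub, Finset.sum_sub_distrib]
  push_cast
  simp

lemma cubeForm_le {d M : ℕ} (w : Fin d → Fin M) (y : Cube d) : cubeForm w y ≤ d * M := by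
  calc cubeForm w y ≤ ∑ _i : Fin d, M := Finset.sum_le_sum fun i _ => by
        split_ifs
        · exact (w i).2.le
        · exact Nat.zero_le _
    _ = d * M := by simp

/-- With `s = ⟨w, y⟩` and `t` a threshold: the sign of `s - t + 1/2` when `s` is `t` or `t - 1`, and
`0` otherwise. -/
def thresholdKernel (s t : ℕ) : ℝ := (if s = t then 1 else 0) - (if s + 1 = t then 1 else 0)

lemma sum_ite_mul_ite {N s s' : ℕ} (hs : s < N) :
    ∑ t : Fin N, (if s = (t : ℕ) then (1 : ℝ) else 0) * (if s' = (t : ℕ) then 1 else 0)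
      = if s = s' then 1 else 0 := by
  rw [Finset.sum_eq_single ⟨s, hs⟩]
  · simp [eq_comm]
  · intro t _ ht
    have : s ≠ (t : ℕ) := fun h => ht (Fin.ext h.symm)
    simp [this]
  · simp

lemma sum_thresholdKernel_mul {N s s' : ℕ} (hs : s + 1 < N) :
    ∑ t : Fin N, thresholdKernel s t * thresholdKernel s' t
      = 2 * (if (s : ℤ) - s' = 0 then 1 else 0) - (if (s : ℤ) - s' = 1 then 1 else 0)
        - (if (s : ℤ) - s' = -1 then 1 else 0) := by
  simp only [thresholdKernel, sub_mul, mul_sub, Finset.sum_sub_distrib,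
    sum_ite_mul_ite hs, sum_ite_mul_ite (lt_of_le_of_lt (Nat.le_succ s) hs)]
  have e1 : ((s : ℤ) - s' = 0) ↔ s = s' := by omega
  have e2 : ((s : ℤ) - s' = 1) ↔ s = s' + 1 := by omega
  have e3 : ((s : ℤ) - s' = -1) ↔ s + 1 = s' := by omega
  simp only [e1, e2, e3, Nat.add_right_cancel_iff]
  ring

lemma sum_abs_thresholdKernel {N s : ℕ} (hs : s + 1 < N) :
    ∑ t : Fin N, |thresholdKernel s t| = 2 := by
  have h : ∀ t : ℕ, |thresholdKernel s t|
      = (if s = t then 1 else 0) * (if s = t then 1 else 0)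
        + (if s + 1 = t then 1 else 0) * (if s + 1 = t then 1 else 0) := by
    intro t
    by_cases h1 : s = t
    · subst h1; simp [thresholdKernel]
    · by_cases h2 : s + 1 = t <;> simp [thresholdKernel, h1, h2]
  simp only [h, Finset.sum_add_distrib, sum_ite_mul_ite hs,
    sum_ite_mul_ite (lt_of_le_of_lt (Nat.le_succ s) hs)]
  norm_num

/-- The second moment of the correlations. Expanding the square leaves, for each pair of points,
a second difference of the law of `⟨w, y - y'⟩`, which is tiny unless the points are close. -/
lemma sum_sq_thresholdKernel_le {d M : ℕ} (hM : 0 < M) {g : Cube d → ℝ} (hg : ∀ y, |g y| ≤ 1) :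
    ∑ a : (Fin d → Fin M) × Fin (d * M + 2),
      (∑ y, thresholdKernel (cubeForm a.1 y) a.2 * g y) ^ 2 ≤
      4 ^ d * (2 * ((M : ℝ) ^ d / M ^ 2)) + 2 ^ d * ((d + 1) * (2 * (M : ℝ) ^ d)) := by
  have hpair : ∀ y y' : Cube d, ∑ w : Fin d → Fin M, ∑ t : Fin (d * M + 2),
      thresholdKernel (cubeForm w y) t * thresholdKernel (cubeForm w y') t
      = 2 * (formCount M (cubeDiff y y') 0 : ℝ) - formCount M (cubeDiff y y') 1
        - formCount M (cubeDiff y y') (-1) := by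
    intro y y'
    have hlt : ∀ w : Fin d → Fin M, cubeForm w y + 1 < d * M + 2 := fun w => by
      have := cubeForm_le w y; omega
    simp only [fun w : Fin d → Fin M => sum_thresholdKernel_mul (s' := cubeForm w y') (hlt w),
      Finset.sum_sub_distrib, ← Finset.mul_sum, formCount, Finset.card_filter, sum_mul_cubeDiff]
    push_cast
    rfl
  have hexp : ∑ a : (Fin d → Fin M) × Fin (d * M + 2),
      (∑ y, thresholdKernel (cubeForm a.1 y) a.2 * g y) ^ 2
      = ∑ y, ∑ y', g y * g y' * (2 * (formCount M (cubeDiff y y') 0 : ℝ)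
        - formCount M (cubeDiff y y') 1 - formCount M (cubeDiff y y') (-1)) := by
    have hprod : ∀ y y' : Cube d, ∑ w : Fin d → Fin M, ∑ t : Fin (d * M + 2),
        thresholdKernel (cubeForm w y) t * thresholdKernel (cubeForm w y') t
        = ∑ a : (Fin d → Fin M) × Fin (d * M + 2),
          thresholdKernel (cubeForm a.1 y) a.2 * thresholdKernel (cubeForm a.1 y') a.2 :=
      fun y y' => by rw [Fintype.sum_prod_type]
    simp only [sq, Finset.sum_mul_sum]
    simp only [← hpair, hprod, Finset.mul_sum]
    rw [Finset.sum_comm]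
    refine Finset.sum_congr rfl fun y _ => ?_
    rw [Finset.sum_comm]
    refine Finset.sum_congr rfl fun y' _ => ?_
    exact Finset.sum_congr rfl fun a _ => by ring
  have hterm : ∀ y y' : Cube d, g y * g y' * (2 * (formCount M (cubeDiff y y') 0 : ℝ)
      - formCount M (cubeDiff y y') 1 - formCount M (cubeDiff y y') (-1))
      ≤ 2 * ((M : ℝ) ^ d / M ^ 2) + if y' ∈ nearPoints y then 2 * (M : ℝ) ^ d else 0 := by
    intro y y'
    set Q := 2 * (formCount M (cubeDiff y y') 0 : ℝ)
      - formCount M (cubeDiff y y') 1 - formCount M (cubeDiff y y') (-1) with hQ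
    have hgg : |g y * g y'| ≤ 1 := by
      rw [abs_mul]; exact mul_le_one₀ (hg y) (abs_nonneg _) (hg y')
    have hle : g y * g y' * Q ≤ |Q| := by
      refine (le_abs_self _).trans ?_
      rw [abs_mul]
      exact mul_le_of_le_one_left (abs_nonneg _) hgg
    refine hle.trans ?_
    split_ifs with hnear
    · have h0 : (formCount M (cubeDiff y y') 0 : ℝ) ≤ (M : ℝ) ^ d := by
        exact_mod_cast formCount_le_pow M _ 0
      have h1 : (formCount M (cubeDiff y y') 1 : ℝ) + formCount M (cubeDiff y y') (-1)
          ≤ (M : ℝ) ^ d := by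
        exact_mod_cast formCount_add_le_pow M _ (show (1 : ℤ) ≠ -1 by decide)
      have h2 : (0 : ℝ) ≤ formCount M (cubeDiff y y') 0 := Nat.cast_nonneg _
      have h3 : (0 : ℝ) ≤ formCount M (cubeDiff y y') 1 := Nat.cast_nonneg _
      have h4 : (0 : ℝ) ≤ formCount M (cubeDiff y y') (-1) := Nat.cast_nonneg _
      have h5 : (0 : ℝ) ≤ (M : ℝ) ^ d := by positivity
      refine le_trans ?_ (le_add_of_nonneg_left (by positivity))
      rw [abs_le]
      constructor <;> linarith
    · obtain ⟨i, j, hij, hi, hj⟩ := exists_two_ne_of_notMem_nearPoints hnear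
      rw [add_zero]
      refine abs_two_mul_formCount_sub_le hM hij ?_ ?_
      · cases h1 : y i <;> cases h2 : y' i <;> simp_all [cubeDiff]
      · cases h1 : y j <;> cases h2 : y' j <;> simp_all [cubeDiff]
  rw [hexp]
  have hcube : (Finset.univ : Finset (Cube d)).card = 2 ^ d := by simp
  calc _ ≤ ∑ y : Cube d, ∑ y' : Cube d, (2 * ((M : ℝ) ^ d / M ^ 2)
        + if y' ∈ nearPoints y then 2 * (M : ℝ) ^ d else 0) :=
        Finset.sum_le_sum fun y _ => Finset.sum_le_sum fun y' _ => hterm y y'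
    _ = ∑ y : Cube d, (2 ^ d * (2 * ((M : ℝ) ^ d / M ^ 2))
        + (nearPoints y).card * (2 * (M : ℝ) ^ d)) := by
        refine Finset.sum_congr rfl fun y _ => ?_
        rw [Finset.sum_add_distrib, Finset.sum_const, hcube, Finset.sum_ite_mem,
          Finset.univ_inter, Finset.sum_const]
        simp [nsmul_eq_mul]
    _ ≤ ∑ _y : Cube d, (2 ^ d * (2 * ((M : ℝ) ^ d / M ^ 2))
        + (d + 1) * (2 * (M : ℝ) ^ d)) := by
        refine Finset.sum_le_sum fun y _ => ?_
        gcongr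
        exact_mod_cast card_nearPoints_le y
    _ = _ := by
        rw [Finset.sum_const, hcube, nsmul_eq_mul]
        push_cast
        rw [show (4 : ℝ) = 2 * 2 by norm_num, mul_pow]
        ring

lemma sum_abs_sq_le_card_mul {α : Type*} [Fintype α] (u : α → ℝ) :
    (∑ a, |u a|) ^ 2 ≤ Fintype.card α * ∑ a, u a ^ 2 := by
  have := sq_sum_le_card_mul_sum_sq (s := Finset.univ) (f := fun a => |u a|)
  simpa using this

lemma decide_le_cubeForm_mem_linearSeparators {d M : ℕ} (w : Fin d → Fin M) (t : ℕ) :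
    (fun y => decide (t ≤ cubeForm w y)) ∈ linearSeparators d := by
  refine ⟨fun i => (w i : ℕ), t, fun y => ?_⟩
  rw [decide_eq_true_eq, ← Nat.cast_le (α := ℝ), cubeForm]
  push_cast
  simp

lemma not_decide_le_cubeForm_mem_linearSeparators {d M : ℕ} (w : Fin d → Fin M) (t : ℕ) :
    (fun y => !decide (t ≤ cubeForm w y)) ∈ linearSeparators d := by
  refine ⟨fun i => -((w i : ℕ) : ℝ), 1 - t, fun y => ?_⟩
  have h : ∑ i, -((w i : ℕ) : ℝ) * (if y i then 1 else 0) = -(cubeForm w y : ℝ) := by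
    rw [cubeForm, Nat.cast_sum, ← Finset.sum_neg_distrib]
    refine Finset.sum_congr rfl fun i _ => ?_
    split_ifs <;> simp
  rw [h, Bool.not_eq_true', decide_eq_false_iff_not, not_le, ← Nat.succ_le_iff,
    ← Nat.cast_le (α := ℝ)]
  push_cast
  constructor <;> intro h <;> linarith

/-- The family of separators `⟨w, ·⟩ ≥ θ`, with `w` uniform in `{0, …, M - 1}^d`, `M = 2^⌊d/2⌋`, and
`θ` one of the two thresholds next to `⟨w, y⟩`, for a uniform point `y`. -/
theorem exists_linearSeparators_kernel (d : ℕ) :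
    ∃ (α : Type) (_ : Fintype α) (f : α → BoolFun d) (K : α → Cube d → ℝ),
      (∀ a, f a ∈ linearSeparators d) ∧ (∀ a, (fun x => !f a x) ∈ linearSeparators d) ∧
      (∀ a x, 0 ≤ boolSign (f a x) * K a x) ∧ 1 ≤ ∑ a, ∑ x, |K a x| ∧
      ∀ g : Cube d → ℝ, (∀ x, |g x| ≤ 1) →
        ∑ a, |∑ x, K a x * g x| ≤ 16 * ((2 : ℝ) ^ ((1 / 8 : ℝ) * d))⁻¹ := by
  set M : ℕ := 2 ^ (d / 2) with hM
  have hM0 : 0 < M := by positivity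
  set κ : ℝ := (2 * 2 ^ d * (M : ℝ) ^ d)⁻¹ with hκ
  have hκ0 : 0 < κ := by positivity
  refine ⟨(Fin d → Fin M) × Fin (d * M + 2), inferInstance,
    fun a y => decide ((a.2 : ℕ) ≤ cubeForm a.1 y),
    fun a y => κ * thresholdKernel (cubeForm a.1 y) a.2,
    fun a => decide_le_cubeForm_mem_linearSeparators a.1 a.2,
    fun a => not_decide_le_cubeForm_mem_linearSeparators a.1 a.2, fun a y => ?_, ?_, ?_⟩
  · simp only [boolSign, thresholdKernel, decide_eq_true_eq]
    split_ifs <;> first | omega | simp [hκ0.le]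
  · have hy : ∀ y : Cube d, ∑ a : (Fin d → Fin M) × Fin (d * M + 2),
        |κ * thresholdKernel (cubeForm a.1 y) a.2| = κ * (M ^ d * 2) := by
      intro y
      simp only [abs_mul, abs_of_pos hκ0, ← Finset.mul_sum]
      have hw : ∀ w : Fin d → Fin M,
          ∑ t : Fin (d * M + 2), |thresholdKernel (cubeForm w y) t| = 2 := fun w =>
        sum_abs_thresholdKernel (by have := cubeForm_le w y; omega)
      rw [Fintype.sum_prod_type]
      simp [hw]
    rw [Finset.sum_comm, Finset.sum_congr rfl fun y _ => hy y]
    simp only [Finset.sum_const, Finset.card_univ, Fintype.card_fun, Fintype.card_bool,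
      Fintype.card_fin, nsmul_eq_mul]
    apply le_of_eq
    rw [hκ]
    push_cast
    field_simp
  · intro g hg
    set X : ℝ := (M : ℝ) with hX
    have hX1 : 1 ≤ X := by rw [hX]; exact_mod_cast hM0
    have hX2 : X ^ 2 ≤ 2 ^ d := by
      rw [hX, hM]; push_cast
      rw [← pow_mul]
      exact pow_le_pow_right₀ (by norm_num) (by omega)
    set Y : ℝ := (2 : ℝ) ^ ((1 / 8 : ℝ) * d) with hY
    have hY0 : 0 < Y := by positivity
    have hY4 : Y ^ 4 ≤ 2 * X := by
      rw [hY, ← Real.rpow_natCast, ← Real.rpow_mul (by norm_num), hX, hM]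
      push_cast
      rw [← pow_succ', ← Real.rpow_natCast]
      apply Real.rpow_le_rpow_of_exponent_le (by norm_num)
      have : (d : ℝ) ≤ 2 * ((d / 2 + 1 : ℕ) : ℝ) := by exact_mod_cast (by omega)
      push_cast at this ⊢
      linarith
    have hYd : (d : ℝ) + 2 ≤ 16 * Y := by
      have h1 : 1 + (1 / 8 : ℝ) * d * Real.log 2 ≤ Y := by
        rw [hY, Real.rpow_def_of_pos (by norm_num)]
        linarith [Real.add_one_le_exp (Real.log 2 * ((1 / 8 : ℝ) * d))]
      have h2 := Real.log_two_gt_d9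
      have h3 : (0 : ℝ) ≤ d := Nat.cast_nonneg d
      nlinarith
    have hlin : ∀ a : (Fin d → Fin M) × Fin (d * M + 2),
        ∑ y, κ * thresholdKernel (cubeForm a.1 y) a.2 * g y
        = κ * ∑ y, thresholdKernel (cubeForm a.1 y) a.2 * g y := by
      intro a
      rw [Finset.mul_sum]
      exact Finset.sum_congr rfl fun y _ => by ring
    have hcs := sum_abs_sq_le_card_mul fun a : (Fin d → Fin M) × Fin (d * M + 2) =>
      ∑ y, κ * thresholdKernel (cubeForm a.1 y) a.2 * g y
    have hsecond := sum_sq_thresholdKernel_le hM0 hg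
    have hcard : (Fintype.card ((Fin d → Fin M) × Fin (d * M + 2)) : ℝ) = X ^ d * (d * X + 2) := by
      simp [hX]
    have hbound : (∑ a : (Fin d → Fin M) × Fin (d * M + 2),
        |∑ y, κ * thresholdKernel (cubeForm a.1 y) a.2 * g y|) ^ 2 ≤ (16 * Y⁻¹) ^ 2 := by
      refine hcs.trans ?_
      simp only [hlin, mul_pow, ← Finset.mul_sum]
      rw [hcard]
      calc _ ≤ X ^ d * (d * X + 2) * (κ ^ 2 * (4 ^ d * (2 * (X ^ d / X ^ 2))
              + 2 ^ d * ((d + 1) * (2 * X ^ d)))) := by gcongr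
        _ = (d * X + 2) / 2 * (1 / X ^ 2 + (d + 1) * (1 / 2 ^ d)) := by
            rw [hκ, show (4 : ℝ) ^ d = 2 ^ d * 2 ^ d by rw [← mul_pow]; norm_num]
            field_simp
        _ ≤ (d * X + 2 * X) / 2 * (1 / X ^ 2 + (d + 1) * (1 / X ^ 2)) := by
            gcongr; linarith
        _ = (d + 2) ^ 2 / (2 * X) := by field_simp; ring
        _ ≤ (16 * Y) ^ 2 / Y ^ 4 := by gcongr
        _ = _ := by field_simp
    exact le_of_sq_le_sq hbound (by positivity)

/-! ### Walsh characters and the lifted kernel -/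

/-- The translation `z ↦ y + z` of the cube. -/
def xorEquiv {I : Type*} (y : I → Bool) : (I → Bool) ≃ (I → Bool) where
  toFun z i := y i ^^ z i
  invFun z i := y i ^^ z i
  left_inv z := by simp
  right_inv z := by simp

lemma xor_xorEquiv {I : Type*} (y z : I → Bool) : (fun i => y i ^^ xorEquiv y z i) = z := by
  funext i
  simp [xorEquiv]

section Walsh

variable {I : Type*} [Fintype I]

/-- The Walsh character `(-1) ^ ⟨S, x⟩` of the cube; sets of coordinates are given by their
indicator functions. -/
def walsh (S x : I → Bool) : ℝ := ∏ i, if S i && x i then -1 else 1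

/-- The (unnormalized) Walsh coefficient of `ψ` at `S`. -/
def walshCoeff [DecidableEq I] (ψ : (I → Bool) → ℝ) (S : I → Bool) : ℝ := ∑ x, ψ x * walsh S x

/-- The number of coordinates at which `S` is `true`. -/
def weight (S : I → Bool) : ℕ := (Finset.univ.filter fun i => S i = true).card

lemma abs_walsh (S x : I → Bool) : |walsh S x| = 1 := by
  rw [walsh, Finset.abs_prod]
  refine Finset.prod_eq_one fun i _ => ?_
  split_ifs <;> simp

lemma walsh_xor (S x y : I → Bool) :
    walsh S (fun i => x i ^^ y i) = walsh S x * walsh S y := by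
  rw [walsh, walsh, walsh, ← Finset.prod_mul_distrib]
  refine Finset.prod_congr rfl fun i _ => ?_
  cases S i <;> cases x i <;> cases y i <;> simp

/-- The part of `x` that is read under the selector `V`: the point `x` contains two copies
`e (i, false)` and `e (i, true)` of every variable `i`, and `V` chooses one of them. -/
def selectCopy {d : ℕ} (e : I × Bool → Fin d) (V : I → Bool) (x : Cube d) : I → Bool :=
  fun i => x (e (i, V i))

/-- The indicator of the set of all `e (i, b)` with `o i = some b`. -/
def copyIndicator {d : ℕ} (e : I × Bool → Fin d) (o : I → Option Bool) : Fin d → Bool :=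
  fun k => decide (∃ p : I × Bool, o p.1 = some p.2 ∧ e p = k)

/-- The copies selected by `V` of the variables in `S`. -/
def partialSelector (S V : I → Bool) : I → Option Bool := fun i => if S i then some (V i) else none

lemma copyIndicator_apply {d : ℕ} {e : I × Bool → Fin d} (he : Function.Injective e)
    (o : I → Option Bool) (i : I) (b : Bool) :
    copyIndicator e o (e (i, b)) = decide (o i = some b) := by
  rw [copyIndicator, decide_eq_decide]
  constructor
  · rintro ⟨p, hp, hpe⟩
    rw [he hpe] at hp
    exact hp
  · exact fun h => ⟨(i, b), h, rfl⟩

lemma copyIndicator_injective {d : ℕ} {e : I × Bool → Fin d} (he : Function.Injective e) :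
    Function.Injective (copyIndicator e) := by
  intro o o' h
  funext i
  ext b
  have := congrFun h (e (i, b))
  rwa [copyIndicator_apply he, copyIndicator_apply he, decide_eq_decide] at this

lemma walsh_selectCopy {d : ℕ} {e : I × Bool → Fin d} (he : Function.Injective e)
    (S V : I → Bool) (x : Cube d) :
    walsh S (selectCopy e V x) = walsh (copyIndicator e (partialSelector S V)) x := by
  rw [walsh, walsh]
  refine Fintype.prod_of_injective (fun i => e (i, V i)) (fun i j h => ?_) _ _ (fun k hk => ?_)
    fun i => ?_
  · exact congrArg Prod.fst (he h)
  · have : copyIndicator e (partialSelector S V) k = false := by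
      rw [copyIndicator, decide_eq_false_iff_not]
      rintro ⟨p, hp, hpe⟩
      refine hk ⟨p.1, ?_⟩
      simp only [partialSelector] at hp
      split_ifs at hp
      simp only [Option.some.injEq] at hp
      simpa [hp] using hpe
    simp [this]
  · rw [copyIndicator_apply he, partialSelector]
    cases S i <;> simp [selectCopy]

lemma two_pow_weight (S : I → Bool) : (2 : ℝ) ^ weight S = ∏ i, if S i then 2 else 1 := by
  rw [weight, Finset.prod_ite]
  simp

variable [DecidableEq I]

lemma sum_prod_eq_prod_sum {κ : Type*} [Fintype κ] (F : I → κ → ℝ) :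
    ∑ x : I → κ, ∏ i, F i (x i) = ∏ i, ∑ a, F i a := by
  rw [Finset.prod_univ_sum, Fintype.piFinset_univ]

lemma sum_walsh_mul_walsh (x y : I → Bool) :
    ∑ S, walsh S x * walsh S y = if x = y then 2 ^ Fintype.card I else 0 := by
  simp only [← walsh_xor]
  simp only [walsh]
  rw [sum_prod_eq_prod_sum fun i s => if (s && (x i ^^ y i)) then (-1 : ℝ) else 1]
  split_ifs with h
  · subst h
    simp [Finset.card_univ]
  · obtain ⟨i, hi⟩ := Function.ne_iff.1 h
    refine Finset.prod_eq_zero (Finset.mem_univ i) ?_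
    have : (x i ^^ y i) = true := by cases h1 : x i <;> cases h2 : y i <;> simp_all
    simp [this]

/-- Parseval's identity. -/
lemma sum_walshCoeff_sq (ψ : (I → Bool) → ℝ) :
    ∑ S, walshCoeff ψ S ^ 2 = 2 ^ Fintype.card I * ∑ x, ψ x ^ 2 := by
  simp only [walshCoeff, sq, Finset.sum_mul_sum]
  rw [Finset.sum_comm, Finset.mul_sum]
  refine Finset.sum_congr rfl fun x _ => ?_
  rw [Finset.sum_comm]
  have h : ∀ y, ∑ S, ψ x * walsh S x * (ψ y * walsh S y)
      = ψ x * ψ y * if x = y then 2 ^ Fintype.card I else 0 := by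
    intro y
    rw [← sum_walsh_mul_walsh, Finset.mul_sum]
    exact Finset.sum_congr rfl fun S _ => by ring
  simp only [h]
  simp
  ring

lemma abs_walshCoeff_le (ψ : (I → Bool) → ℝ) (S : I → Bool) :
    |walshCoeff ψ S| ≤ ∑ x, |ψ x| := by
  refine (Finset.abs_sum_le_sum_abs _ _).trans (le_of_eq ?_)
  simp only [abs_mul, abs_walsh, mul_one]

/-- A partial selector with support `S` extends to `2 ^ (|I| - |S|)` selectors. -/
lemma sum_two_pow_weight_mul_partialSelector (h : (I → Option Bool) → ℝ) :
    ∑ V : I → Bool, ∑ S : I → Bool, 2 ^ weight S * h (partialSelector S V)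
      = 2 ^ Fintype.card I * ∑ o, h o := by
  -- The weight and the condition that `(S, V)` restricts to `o` are products over the coordinates,
  -- so that the total weight of a fibre can be computed coordinate by coordinate.
  have hexpand : ∀ V S : I → Bool, 2 ^ weight S * h (partialSelector S V)
      = ∑ o, (∏ i, if (if S i then some (V i) else none) = o i
          then (if S i then 2 else 1 : ℝ) else 0) * h o := by
    intro V S
    rw [Finset.sum_eq_single (partialSelector S V), two_pow_weight]
    · simp [partialSelector]
    · intro o _ ho
      obtain ⟨i, hi⟩ := Function.ne_iff.1 ho
      rw [Finset.prod_eq_zero (Finset.mem_univ i), zero_mul]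
      rw [if_neg]
      exact fun h => hi h.symm
    · simp
  have hfiber : ∀ o : I → Option Bool, ∑ V : I → Bool, ∑ S : I → Bool,
      (∏ i, if (if S i then some (V i) else none) = o i
          then (if S i then 2 else 1 : ℝ) else 0) = 2 ^ Fintype.card I := by
    intro o
    rw [← Fintype.sum_prod_type', ← (Equiv.arrowProdEquivProdArrow I (fun _ => Bool)
      (fun _ => Bool)).sum_comp]
    simp only [Equiv.arrowProdEquivProdArrow_apply]
    rw [sum_prod_eq_prod_sum fun i (p : Bool × Bool) =>
      if (if p.2 then some p.1 else none) = o i then (if p.2 then 2 else 1 : ℝ) else 0]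
    rw [← Finset.card_univ, ← Finset.prod_const]
    refine Finset.prod_congr rfl fun i _ => ?_
    rw [Fintype.sum_prod_type]
    rcases o i with _ | b
    · simp
    · cases b <;> simp
  simp only [hexpand]
  rw [Finset.sum_congr rfl fun V _ => Finset.sum_comm, Finset.sum_comm, Finset.mul_sum]
  refine Finset.sum_congr rfl fun o _ => ?_
  rw [← hfiber o, Finset.sum_mul]
  exact Finset.sum_congr rfl fun V _ => by rw [Finset.sum_mul]

/-- The kernel `Ψ(x_V + w)`, indexed by selectors `V` and translations `w`. -/
noncomputable def liftedKernel {d : ℕ} (e : I × Bool → Fin d) (Ψ : (I → Bool) → ℝ)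
    (a : (I → Bool) × (I → Bool)) (x : Cube d) : ℝ :=
  (2 ^ d * 2 ^ Fintype.card I)⁻¹ * Ψ (fun i => selectCopy e a.1 x i ^^ a.2 i)

lemma sum_abs_liftedKernel {d : ℕ} (e : I × Bool → Fin d) (Ψ : (I → Bool) → ℝ) :
    ∑ a, ∑ x, |liftedKernel e Ψ a x| = ∑ z, |Ψ z| := by
  rw [Fintype.sum_prod_type]
  have h : ∀ V : I → Bool, ∑ w : I → Bool, ∑ x, |liftedKernel e Ψ (V, w) x|
      = (2 ^ Fintype.card I)⁻¹ * ∑ z, |Ψ z| := by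
    intro V
    rw [Finset.sum_comm]
    have hx : ∀ x : Cube d, ∑ w : I → Bool, |liftedKernel e Ψ (V, w) x|
        = (2 ^ d * 2 ^ Fintype.card I)⁻¹ * ∑ z, |Ψ z| := by
      intro x
      rw [← (xorEquiv (selectCopy e V x)).sum_comp, Finset.mul_sum]
      refine Finset.sum_congr rfl fun w _ => ?_
      rw [liftedKernel, abs_mul, abs_of_pos (by positivity)]
      simp only [xor_xorEquiv]
    simp only [hx, Finset.sum_const, Finset.card_univ, Fintype.card_fun, Fintype.card_bool,
      Fintype.card_fin, nsmul_eq_mul]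
    push_cast
    field_simp
  simp only [h, Finset.sum_const, Finset.card_univ, Fintype.card_fun, Fintype.card_bool,
    nsmul_eq_mul]
  push_cast
  field_simp

/-- As a function of the translation, the correlation of the lifted kernel with `g` has Walsh
coefficients that are products of coefficients of `Ψ` and of `g`. -/
lemma walshCoeff_correlation {d : ℕ} {e : I × Bool → Fin d} (he : Function.Injective e)
    (Ψ : (I → Bool) → ℝ) (g : Cube d → ℝ) (V S : I → Bool) :
    walshCoeff (fun w => ∑ x, Ψ (fun i => selectCopy e V x i ^^ w i) * g x) S
      = walshCoeff Ψ S * walshCoeff g (copyIndicator e (partialSelector S V)) := by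
  rw [walshCoeff]
  simp only [Finset.sum_mul]
  rw [Finset.sum_comm, walshCoeff, walshCoeff, Finset.mul_sum]
  refine Finset.sum_congr rfl fun x _ => ?_
  rw [← (xorEquiv (selectCopy e V x)).sum_comp, ← walsh_selectCopy he, Finset.sum_mul]
  refine Finset.sum_congr rfl fun z _ => ?_
  have : walsh S (xorEquiv (selectCopy e V x) z) = walsh S (selectCopy e V x) * walsh S z :=
    walsh_xor S _ z
  rw [this, xor_xorEquiv]
  ring

/-- Random selectors damp the Walsh coefficient of `Ψ` at `S` by the factor `2 ^ (-|S| / 2)`, and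
the discrepancy of the lifted kernel is at most the largest damped coefficient. -/
theorem sum_abs_liftedKernel_mul_le {d : ℕ} {e : I × Bool → Fin d} (he : Function.Injective e)
    {Ψ : (I → Bool) → ℝ} {η : ℝ} (hη : 0 ≤ η)
    (hΨ : ∀ S, walshCoeff Ψ S ^ 2 ≤ η ^ 2 * 2 ^ weight S) {g : Cube d → ℝ}
    (hg : ∀ x, |g x| ≤ 1) :
    ∑ a, |∑ x, liftedKernel e Ψ a x * g x| ≤ η := by
  set k := Fintype.card I
  let G : (I → Bool) → (I → Bool) → ℝ := fun V w =>
    ∑ x, Ψ (fun i => selectCopy e V x i ^^ w i) * g x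
  have hsum_g : ∑ o, walshCoeff g (copyIndicator e o) ^ 2 ≤ 4 ^ d := by
    calc _ ≤ ∑ B, walshCoeff g B ^ 2 := by
          rw [← Finset.sum_image (s := Finset.univ) (g := copyIndicator e)
            (f := fun B => walshCoeff g B ^ 2) (fun _ _ _ _ h => copyIndicator_injective he h)]
          exact Finset.sum_le_univ_sum_of_nonneg fun _ => sq_nonneg _
      _ = 2 ^ d * ∑ x, g x ^ 2 := by rw [sum_walshCoeff_sq, Fintype.card_fin]
      _ ≤ 2 ^ d * ∑ _x : Cube d, 1 := by
          gcongr with x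
          rw [← sq_abs]
          exact pow_le_one₀ (abs_nonneg _) (hg x)
      _ = 4 ^ d := by
          simp only [Finset.sum_const, Finset.card_univ, Fintype.card_fun, Fintype.card_bool,
            Fintype.card_fin, nsmul_eq_mul, mul_one]
          push_cast
          rw [← mul_pow]; norm_num
  have hG : ∑ V, ∑ w, G V w ^ 2 ≤ η ^ 2 * 4 ^ d := by
    have hV : ∀ V, ∑ w, G V w ^ 2 ≤ (2 ^ k)⁻¹ * (η ^ 2 *
        ∑ S, 2 ^ weight S * walshCoeff g (copyIndicator e (partialSelector S V)) ^ 2) := by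
      intro V
      rw [le_inv_mul_iff₀ (by positivity), ← sum_walshCoeff_sq, Finset.mul_sum]
      refine Finset.sum_le_sum fun S _ => ?_
      rw [walshCoeff_correlation he, mul_pow, ← mul_assoc]
      gcongr
      exact hΨ S
    calc _ ≤ ∑ V, (2 ^ k)⁻¹ * (η ^ 2 *
          ∑ S, 2 ^ weight S * walshCoeff g (copyIndicator e (partialSelector S V)) ^ 2) :=
          Finset.sum_le_sum fun V _ => hV V
      _ = (2 ^ k)⁻¹ * (η ^ 2 * (2 ^ k * ∑ o, walshCoeff g (copyIndicator e o) ^ 2)) := by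
          rw [← Finset.mul_sum, ← Finset.mul_sum, sum_two_pow_weight_mul_partialSelector
            fun o => walshCoeff g (copyIndicator e o) ^ 2]
      _ = η ^ 2 * ∑ o, walshCoeff g (copyIndicator e o) ^ 2 := by field_simp
      _ ≤ _ := by gcongr
  have hcs := sq_sum_le_card_mul_sum_sq (s := Finset.univ)
    (f := fun a => |∑ x, liftedKernel e Ψ a x * g x|)
  have hlin : ∀ a, ∑ x, liftedKernel e Ψ a x * g x = (2 ^ d * 2 ^ k)⁻¹ * G a.1 a.2 := by
    intro a
    simp only [G, liftedKernel, Finset.mul_sum, mul_assoc, k]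
  refine le_of_sq_le_sq (hcs.trans ?_) hη
  simp only [sq_abs, hlin, mul_pow, ← Finset.mul_sum]
  rw [Fintype.sum_prod_type]
  have hcard : ((Finset.univ : Finset ((I → Bool) × (I → Bool))).card : ℝ) = 2 ^ k * 2 ^ k := by
    simp [Finset.card_univ, k]
  rw [hcard]
  calc _ ≤ 2 ^ k * 2 ^ k * (((2 ^ d * 2 ^ k)⁻¹) ^ 2 * (η ^ 2 * (4 : ℝ) ^ d)) := by gcongr
    _ = η ^ 2 := by
      rw [show (4 : ℝ) ^ d = 2 ^ d * 2 ^ d by rw [← mul_pow]; norm_num]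
      field_simp

end Walsh

/-! ### A signed measure on a block that annihilates low-degree characters -/

/-- The product measure on the cube under which every coordinate is `true` with probability `q`. -/
def bernoulliWeight {m : ℕ} (q : ℝ) (x : Fin m → Bool) : ℝ := ∏ i, if x i then q else 1 - q

lemma bernoulliWeight_nonneg {m : ℕ} {q : ℝ} (h0 : 0 ≤ q) (h1 : q ≤ 1) (x : Fin m → Bool) :
    0 ≤ bernoulliWeight q x :=
  Finset.prod_nonneg fun i _ => by split_ifs <;> linarith

lemma sum_bernoulliWeight {m : ℕ} (q : ℝ) : ∑ x : Fin m → Bool, bernoulliWeight q x = 1 := by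
  simp only [bernoulliWeight]
  rw [sum_prod_eq_prod_sum fun (_ : Fin m) (b : Bool) => if b then q else 1 - q]
  simp

lemma bernoulliWeight_false {m : ℕ} (q : ℝ) :
    bernoulliWeight q (fun _ : Fin m => false) = (1 - q) ^ m := by
  simp [bernoulliWeight]

lemma bernoulliWeight_zero {m : ℕ} {x : Fin m → Bool} (hx : x ≠ fun _ => false) :
    bernoulliWeight 0 x = 0 := by
  obtain ⟨i, hi⟩ := Function.ne_iff.1 hx
  exact Finset.prod_eq_zero (Finset.mem_univ i) (by simpa using hi)

lemma walshCoeff_bernoulliWeight {m : ℕ} (q : ℝ) (S : Fin m → Bool) :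
    walshCoeff (bernoulliWeight q) S = (1 - 2 * q) ^ weight S := by
  simp only [walshCoeff, bernoulliWeight, walsh, ← Finset.prod_mul_distrib]
  rw [sum_prod_eq_prod_sum fun i b =>
    (if b then q else 1 - q) * (if (S i && b) then (-1 : ℝ) else 1)]
  rw [weight, ← Finset.prod_const, Finset.prod_filter]
  refine Finset.prod_congr rfl fun i _ => ?_
  cases S i
  · simp
  · simp; ring

/-- The signed binomial coefficients of the `2N`-th finite difference. -/
def altChoose (N j : ℕ) : ℝ := (-1) ^ (2 * N - j) * ((2 * N).choose j)

lemma sum_altChoose_mul_eval {N : ℕ} {P : Polynomial ℝ} (hP : P.natDegree < 2 * N) :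
    ∑ j ∈ Finset.range (2 * N + 1), altChoose N j * P.eval (j : ℝ) = 0 := by
  have h := congrFun (Polynomial.fwdDiff_iter_eq_zero_of_degree_lt hP) 0
  rw [fwdDiff_iter_eq_sum_shift] at h
  rw [Pi.zero_apply] at h
  rw [← h]
  refine Finset.sum_congr rfl fun j _ => ?_
  simp [altChoose]

lemma altChoose_self_ne_zero (N : ℕ) : altChoose N N ≠ 0 := by
  have : (2 * N).choose N ≠ 0 := (Nat.choose_pos (by omega)).ne'
  simp [altChoose, this]

lemma abs_altChoose_le (N j : ℕ) : |altChoose N j| ≤ |altChoose N N| := by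
  simp only [altChoose, abs_mul, abs_pow, abs_neg, abs_one, one_pow, one_mul, Nat.abs_cast]
  exact_mod_cast Nat.choose_le_centralBinom j N

/-- The coefficient of the node `(j - N)^2`; dividing by `17 (j - N)^2 - 1` introduces the
additional node `1 / 17` and makes the coefficients away from `j = N` summably small. -/
noncomputable def nodeCoeff (N j : ℕ) : ℝ :=
  -altChoose N j / (altChoose N N * (17 * ((j : ℝ) - N) ^ 2 - 1))

lemma nodeCoeff_self (N : ℕ) : nodeCoeff N N = 1 := by
  simp [nodeCoeff, altChoose_self_ne_zero]

lemma one_le_sub_sq {N j : ℕ} (h : j ≠ N) : 1 ≤ ((j : ℝ) - N) ^ 2 := by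
  have h1 : (1 : ℤ) ≤ ((j : ℤ) - N) ^ 2 := by
    have : ((j : ℤ) - N) ≠ 0 := by omega
    have := pow_pos (abs_pos.2 this) 2
    rw [sq_abs] at this
    omega
  exact_mod_cast h1

lemma node_ne_zero (N j : ℕ) : 17 * ((j : ℝ) - N) ^ 2 - 1 ≠ 0 := by
  by_cases h : j = N
  · simp [h]
  · linarith [one_le_sub_sq h]

lemma abs_nodeCoeff_le {N j : ℕ} (h : j ≠ N) :
    |nodeCoeff N j| ≤ 1 / 16 * (1 / ((j : ℝ) - N) ^ 2) := by
  have h1 := one_le_sub_sq h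
  have h2 : 0 < |altChoose N N| := abs_pos.2 (altChoose_self_ne_zero N)
  rw [nodeCoeff, abs_div, abs_neg, abs_mul,
    abs_of_pos (show 0 < 17 * ((j : ℝ) - N) ^ 2 - 1 by linarith), div_mul_div_comm, one_mul]
  rw [div_le_div_iff₀ (by nlinarith) (by linarith)]
  calc |altChoose N j| * (16 * ((j : ℝ) - N) ^ 2)
      ≤ |altChoose N N| * (17 * ((j : ℝ) - N) ^ 2 - 1) :=
        mul_le_mul (abs_altChoose_le N j) (by linarith) (by positivity) h2.le
    _ = _ := by ring

lemma sum_one_div_sq_le (N : ℕ) :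
    ∑ i ∈ Finset.range N, 1 / ((i : ℝ) + 1) ^ 2 ≤ 2 - 1 / (N : ℝ) := by
  induction N with
  | zero => simp
  | succ N ih =>
    rw [Finset.sum_range_succ]
    rcases Nat.eq_zero_or_pos N with rfl | hN
    · norm_num
    · have hN' : (0 : ℝ) < N := by exact_mod_cast hN
      have : 1 / ((N : ℝ) + 1) ^ 2 ≤ 1 / (N : ℝ) - 1 / ((N : ℝ) + 1) := by
        rw [div_sub_div _ _ (by positivity) (by positivity),
          div_le_div_iff₀ (by positivity) (by positivity)]
        nlinarith
      push_cast
      linarith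

lemma sum_range_erase_le (N : ℕ) :
    ∑ j ∈ (Finset.range (2 * N + 1)).erase N, 1 / ((j : ℝ) - N) ^ 2 ≤ 4 := by
  have hsplit : ∑ j ∈ Finset.range (2 * N + 1), 1 / ((j : ℝ) - N) ^ 2
      = 2 * ∑ i ∈ Finset.range N, 1 / ((i : ℝ) + 1) ^ 2 := by
    rw [show 2 * N + 1 = N + (N + 1) by ring, Finset.sum_range_add, Finset.sum_range_succ',
      ← Finset.sum_range_reflect]
    have h1 : ∑ j ∈ Finset.range N, 1 / (((N - 1 - j : ℕ) : ℝ) - N) ^ 2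
        = ∑ i ∈ Finset.range N, 1 / ((i : ℝ) + 1) ^ 2 := by
      refine Finset.sum_congr rfl fun j hj => ?_
      have hj' := Finset.mem_range.1 hj
      rw [Nat.cast_sub (by omega), Nat.cast_sub (by omega)]
      congr 1
      push_cast
      ring
    rw [h1]
    push_cast
    simp
    ring
  have hN : N ∈ Finset.range (2 * N + 1) := Finset.mem_range.2 (by omega)
  have h := Finset.add_sum_erase _ (fun j : ℕ => 1 / ((j : ℝ) - N) ^ 2) hN
  simp only [sub_self] at h
  rw [hsplit] at h
  have h2 := sum_one_div_sq_le N
  norm_num at h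
  norm_num at h2
  norm_num
  have h4 : (0 : ℝ) ≤ (N : ℝ)⁻¹ := by positivity
  linarith

lemma sum_abs_nodeCoeff_le (N : ℕ) :
    ∑ j ∈ (Finset.range (2 * N + 1)).erase N, |nodeCoeff N j| ≤ 1 / 4 := by
  calc _ ≤ ∑ j ∈ (Finset.range (2 * N + 1)).erase N, 1 / 16 * (1 / ((j : ℝ) - N) ^ 2) :=
        Finset.sum_le_sum fun j hj => abs_nodeCoeff_le (Finset.ne_of_mem_erase hj)
    _ ≤ _ := by
        rw [← Finset.mul_sum]
        linarith [sum_range_erase_le N]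

/-- The coefficients `nodeCoeff N j`, together with minus their sum at the additional node,
annihilate all polynomials of degree at most `N`. -/
lemma sum_nodeCoeff_mul_sub_eq_zero {N a : ℕ} (ha : a ≤ N) (hN : 1 ≤ N) :
    ∑ j ∈ Finset.range (2 * N + 1), nodeCoeff N j *
      ((1 - 2 * (((j : ℝ) - N) / N) ^ 2) ^ a - (1 - 2 * (1 / (17 * (N : ℝ) ^ 2))) ^ a) = 0 := by
  have hN' : (N : ℝ) ≠ 0 := by positivity
  set y : ℝ := 1 - 2 * (1 / (17 * (N : ℝ) ^ 2)) with hy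
  rcases Nat.eq_zero_or_pos a with rfl | ha0
  · simp
  let X : Polynomial ℝ :=
    Polynomial.C 1 - Polynomial.C (2 / (N : ℝ) ^ 2) * (Polynomial.X - Polynomial.C (N : ℝ)) ^ 2
  let P : Polynomial ℝ := ∑ l ∈ Finset.range a, X ^ l * Polynomial.C (y ^ (a - 1 - l))
  have hXdeg : X.natDegree ≤ 2 := by
    refine (Polynomial.natDegree_sub_le _ _).trans (max_le (by simp) ?_)
    refine (Polynomial.natDegree_C_mul_le _ _).trans ?_
    refine (Polynomial.natDegree_pow_le).trans ?_
    rw [Polynomial.natDegree_X_sub_C]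
  have hPdeg : P.natDegree < 2 * N := by
    refine lt_of_le_of_lt (Polynomial.natDegree_sum_le_of_forall_le (n := 2 * (a - 1)) _ _
      fun l hl => ?_) (by omega)
    refine (Polynomial.natDegree_mul_C_le _ _).trans (Polynomial.natDegree_pow_le.trans ?_)
    have := Finset.mem_range.1 hl
    calc l * X.natDegree ≤ (a - 1) * 2 := Nat.mul_le_mul (by omega) hXdeg
      _ = _ := by ring
  have hXeval : ∀ t : ℝ, X.eval t = 1 - 2 * ((t - N) / N) ^ 2 := by
    intro t
    simp [X]
    ring
  have hterm : ∀ j : ℕ, nodeCoeff N j * ((1 - 2 * (((j : ℝ) - N) / N) ^ 2) ^ a - y ^ a)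
      = 2 / (17 * (N : ℝ) ^ 2 * altChoose N N) * (altChoose N j * P.eval (j : ℝ)) := by
    intro j
    -- Factoring `u ^ a - y ^ a` cancels the factor `17 (j - N)^2 - 1` of the denominator.
    have hPeval : P.eval (j : ℝ) * ((1 - 2 * (((j : ℝ) - N) / N) ^ 2) - y)
        = (1 - 2 * (((j : ℝ) - N) / N) ^ 2) ^ a - y ^ a := by
      rw [← (Commute.all _ _).geom_sum₂_mul]
      congr 1
      simp [P, Polynomial.eval_finsetSum, hXeval]
    rw [← hPeval, nodeCoeff, hy]
    have h1 := node_ne_zero N j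
    have h2 := altChoose_self_ne_zero N
    field_simp
    ring
  simp only [hterm]
  rw [← Finset.mul_sum, sum_altChoose_mul_eval hPdeg, mul_zero]

/-- The dual form of the Markov-type bound for polynomials of degree `N` on a block of `34 N²`
variables: such a polynomial that is positive at the origin and nonpositive elsewhere must be, in
absolute value, twice as large somewhere as at the origin. -/
theorem exists_blockKernel {N : ℕ} (hN : 1 ≤ N) :
    ∃ ψ : (Fin (34 * N ^ 2) → Bool) → ℝ, ψ (fun _ => false) = 1 ∧
      ∑ x ∈ Finset.univ.erase (fun _ => false), max (ψ x) 0 ≤ 1 / 2 ∧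
      ∀ S, weight S ≤ N → walshCoeff ψ S = 0 := by
  have hN' : (0 : ℝ) < N := by positivity
  have hN1 : (1 : ℝ) ≤ N := by exact_mod_cast hN
  set s := (Finset.range (2 * N + 1)).erase N with hs
  have hNmem : N ∈ Finset.range (2 * N + 1) := Finset.mem_range.2 (by omega)
  set q : ℕ → ℝ := fun j => (((j : ℝ) - N) / N) ^ 2 with hq
  set q' : ℝ := 1 / (17 * (N : ℝ) ^ 2) with hq'
  set a' : ℝ := ∑ j ∈ Finset.range (2 * N + 1), nodeCoeff N j with ha'
  have hq0 : ∀ j, 0 ≤ q j := fun j => sq_nonneg _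
  have hq1 : ∀ j ∈ Finset.range (2 * N + 1), q j ≤ 1 := by
    intro j hj
    have hj' : (j : ℝ) ≤ 2 * N := by
      exact_mod_cast Nat.lt_succ_iff.1 (Finset.mem_range.1 hj)
    have hj0 : (0 : ℝ) ≤ j := Nat.cast_nonneg j
    simp only [hq]
    rw [div_pow, div_le_one (by positivity)]
    nlinarith
  have hqN : q N = 0 := by simp [hq]
  have hq'0 : 0 ≤ q' := by positivity
  have hq'1 : q' ≤ 1 := by
    rw [hq', div_le_one (by positivity)]; nlinarith
  have hsmall := sum_abs_nodeCoeff_le N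
  rw [← hs] at hsmall
  have ha'eq : a' = 1 + ∑ j ∈ s, nodeCoeff N j := by
    rw [ha', ← Finset.add_sum_erase _ _ hNmem, nodeCoeff_self]
  have habs := Finset.abs_sum_le_sum_abs (nodeCoeff N) s
  have ha'0 : 0 ≤ a' := by
    have := neg_abs_le (∑ j ∈ s, nodeCoeff N j); linarith
  have ha'1 : a' ≤ 5 / 4 := by
    have := le_abs_self (∑ j ∈ s, nodeCoeff N j); linarith
  -- The nodes are biases of product measures. The node `j = N` is the point mass at the origin, the
  -- other `j` carry total mass at most `1/4`, and the additional node has a negative coefficient.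
  let φ : (Fin (34 * N ^ 2) → Bool) → ℝ := fun x =>
    ∑ j ∈ Finset.range (2 * N + 1), nodeCoeff N j * bernoulliWeight (q j) x
      - a' * bernoulliWeight q' x
  have hφ : ∀ x, φ x = bernoulliWeight 0 x + ∑ j ∈ s, nodeCoeff N j * bernoulliWeight (q j) x
      - a' * bernoulliWeight q' x := by
    intro x
    simp only [φ]
    rw [← Finset.add_sum_erase _ _ hNmem, nodeCoeff_self, one_mul, hqN]
  have hbound : ∀ x : Fin (34 * N ^ 2) → Bool, |∑ j ∈ s, nodeCoeff N j * bernoulliWeight (q j) x|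
      ≤ ∑ j ∈ s, |nodeCoeff N j| * bernoulliWeight (q j) x := by
    intro x
    refine (Finset.abs_sum_le_sum_abs _ _).trans (Finset.sum_le_sum fun j hj => ?_)
    rw [abs_mul, abs_of_nonneg (bernoulliWeight_nonneg (hq0 j)
      (hq1 j (Finset.mem_of_mem_erase hj)) x)]
  have hzero : 1 / 2 ≤ φ fun _ => false := by
    have h1 : (1 - q') ^ (34 * N ^ 2) ≤ 1 / 5 := by
      calc (1 - q') ^ (34 * N ^ 2) ≤ Real.exp (-q') ^ (34 * N ^ 2) := by
            gcongr
            linarith [Real.add_one_le_exp (-q')]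
        _ = Real.exp (-2) := by
            rw [← Real.exp_nat_mul, hq']
            congr 1
            push_cast
            field_simp
            norm_num
        _ ≤ 1 / 5 := by
            rw [Real.exp_neg, ← one_div]
            apply one_div_le_one_div_of_le (by norm_num)
            have h := Real.exp_one_gt_d9
            rw [show (2 : ℝ) = 1 + 1 by norm_num, Real.exp_add]
            nlinarith
    have h2 : ∑ j ∈ s, |nodeCoeff N j| * bernoulliWeight (q j)
        (fun _ : Fin (34 * N ^ 2) => false) ≤ 1 / 4 := by
      refine le_trans (Finset.sum_le_sum fun j hj => ?_) hsmall
      rw [bernoulliWeight_false]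
      have hj := hq1 j (Finset.mem_of_mem_erase hj)
      exact mul_le_of_le_one_right (abs_nonneg _)
        (pow_le_one₀ (by linarith) (by linarith [hq0 j]))
    have h3 := neg_abs_le (∑ j ∈ s, nodeCoeff N j * bernoulliWeight (q j)
      (fun _ : Fin (34 * N ^ 2) => false))
    have h4 := hbound fun _ => false
    have h5 : a' * (1 - q') ^ (34 * N ^ 2) ≤ 5 / 4 * (1 / 5) :=
      mul_le_mul ha'1 h1 (pow_nonneg (by linarith) _) (by norm_num)
    rw [hφ, bernoulliWeight_false q', bernoulliWeight_false 0]
    norm_num at h5 ⊢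
    linarith
  have hpos : ∑ x ∈ Finset.univ.erase (fun _ => false), max (φ x) 0 ≤ 1 / 4 := by
    calc _ ≤ ∑ x ∈ Finset.univ.erase (fun _ => false),
          ∑ j ∈ s, |nodeCoeff N j| * bernoulliWeight (q j) x := by
          refine Finset.sum_le_sum fun x hx => max_le ?_ ((abs_nonneg _).trans (hbound x))
          rw [hφ, bernoulliWeight_zero (Finset.ne_of_mem_erase hx)]
          have h1 := mul_nonneg ha'0 (bernoulliWeight_nonneg hq'0 hq'1 x)
          have h2 := le_abs_self (∑ j ∈ s, nodeCoeff N j * bernoulliWeight (q j) x)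
          linarith [hbound x]
      _ ≤ ∑ x : Fin (34 * N ^ 2) → Bool, ∑ j ∈ s, |nodeCoeff N j| * bernoulliWeight (q j) x :=
          Finset.sum_le_sum_of_subset_of_nonneg (Finset.subset_univ _)
            fun x _ _ => (abs_nonneg _).trans (hbound x)
      _ = ∑ j ∈ s, |nodeCoeff N j| := by
          rw [Finset.sum_comm]
          simp only [← Finset.mul_sum, sum_bernoulliWeight, mul_one]
      _ ≤ _ := hsmall
  have hφ0 : 0 < φ fun _ => false := by linarith
  refine ⟨fun x => φ x / φ fun _ => false, div_self hφ0.ne', ?_, fun S hS => ?_⟩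
  · have h : ∀ x, max (φ x / φ fun _ => false) 0 = max (φ x) 0 / φ fun _ => false := by
      intro x
      rw [← max_div_div_right hφ0.le, zero_div]
    simp only [h, ← Finset.sum_div]
    rw [div_le_iff₀ hφ0]
    linarith
  · have hcoeff : walshCoeff φ S = 0 := by
      rw [← sum_nodeCoeff_mul_sub_eq_zero hS hN]
      simp only [mul_sub, Finset.sum_sub_distrib, ← Finset.sum_mul]
      rw [← hq', ← ha', ← walshCoeff_bernoulliWeight q' S]
      simp only [← walshCoeff_bernoulliWeight, walshCoeff, φ, sub_mul, Finset.sum_sub_distrib,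
        Finset.sum_mul, Finset.mul_sum, mul_assoc]
      rw [Finset.sum_comm]
    have : walshCoeff (fun x => φ x / φ fun _ => false) S
        = walshCoeff φ S / φ fun _ => false := by
      simp only [walshCoeff, Finset.sum_div]
      exact Finset.sum_congr rfl fun x _ => by ring
    rw [this, hcoeff, zero_div]

/-! ### A sign-consistent kernel for a decision list on many blocks -/

section Blocks

variable {m : ℕ}

/-- The positive part of `ψ` away from the origin. -/
noncomputable def offPos (ψ : (Fin m → Bool) → ℝ) (x : Fin m → Bool) : ℝ :=
  if x = fun _ => false then 0 else max (ψ x) 0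

/-- The negative part of `ψ` away from the origin. -/
noncomputable def offNeg (ψ : (Fin m → Bool) → ℝ) (x : Fin m → Bool) : ℝ :=
  if x = fun _ => false then 0 else max (-ψ x) 0

/-- The function that is decided by the first nonzero block. The value is constant on the nonzero
points of a block and alternates from block to block; it is `true` if all blocks are zero. -/
def firstBlockSign : (r : ℕ) → (Fin r → Fin m → Bool) → Bool
  | 0, _ => true
  | r + 1, x => if x 0 = fun _ => false then firstBlockSign r (Fin.tail x) else decide (Odd r)

/-- The part of the kernel that has the wrong sign. -/
noncomputable def badKernel (ψ : (Fin m → Bool) → ℝ) (r : ℕ) (x : Fin r → Fin m → Bool) : ℝ :=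
  -(-1) ^ r * ∏ j, offPos ψ (x j)

/-- The part of the kernel that has the sign of `firstBlockSign`. In the recursion the wrong part
`W` of the kernel for `r` blocks, placed at the origin of the new first block, is replaced by
`-(offPos ψ - offNeg ψ) ⊗ W`, that is, a multiple of `ψ` in the new block is subtracted. -/
noncomputable def goodKernel (ψ : (Fin m → Bool) → ℝ) : (r : ℕ) → (Fin r → Fin m → Bool) → ℝ
  | 0, _ => 1
  | r + 1, x => (if x 0 = fun _ => false then 1 else 0) * goodKernel ψ r (Fin.tail x)
      + offNeg ψ (x 0) * badKernel ψ r (Fin.tail x)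

lemma offPos_nonneg (ψ : (Fin m → Bool) → ℝ) (x : Fin m → Bool) : 0 ≤ offPos ψ x := by
  rw [offPos]; split_ifs <;> simp

lemma offNeg_nonneg (ψ : (Fin m → Bool) → ℝ) (x : Fin m → Bool) : 0 ≤ offNeg ψ x := by
  rw [offNeg]; split_ifs <;> simp

lemma eq_add_offPos_sub_offNeg {ψ : (Fin m → Bool) → ℝ} (h0 : ψ (fun _ => false) = 1)
    (x : Fin m → Bool) :
    ψ x = (if x = fun _ => false then 1 else 0) + offPos ψ x - offNeg ψ x := by
  rw [offPos, offNeg]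
  split_ifs with hx
  · rw [hx, h0]; ring
  · have := max_zero_sub_eq_self (ψ x)
    rw [max_comm, max_comm 0] at this
    linarith

lemma badKernel_succ (ψ : (Fin m → Bool) → ℝ) (r : ℕ) (x : Fin (r + 1) → Fin m → Bool) :
    badKernel ψ (r + 1) x = -(offPos ψ (x 0) * badKernel ψ r (Fin.tail x)) := by
  rw [badKernel, badKernel, Fin.prod_univ_succ, pow_succ]
  simp only [Fin.tail]
  ring

lemma boolSign_mul_badKernel_nonneg (ψ : (Fin m → Bool) → ℝ) (r : ℕ)
    (x : Fin r → Fin m → Bool) : 0 ≤ boolSign (decide (Odd r)) * badKernel ψ r x := by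
  have h : 0 ≤ ∏ j, offPos ψ (x j) := Finset.prod_nonneg fun j _ => offPos_nonneg ψ _
  rw [badKernel, boolSign]
  by_cases hr : Odd r
  · simpa [hr, hr.neg_one_pow] using h
  · simpa [hr, (Nat.not_odd_iff_even.1 hr).neg_one_pow] using h

lemma boolSign_mul_goodKernel_nonneg (ψ : (Fin m → Bool) → ℝ) (r : ℕ)
    (x : Fin r → Fin m → Bool) : 0 ≤ boolSign (firstBlockSign r x) * goodKernel ψ r x := by
  induction r with
  | zero => simp [goodKernel, firstBlockSign, boolSign]
  | succ r ih =>
    rw [firstBlockSign, goodKernel]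
    split_ifs with hx
    · simpa [offNeg, hx] using ih (Fin.tail x)
    · have := mul_nonneg (offNeg_nonneg ψ (x 0)) (boolSign_mul_badKernel_nonneg ψ r (Fin.tail x))
      rw [zero_mul, zero_add]
      linarith

lemma sum_cons {r : ℕ} (F : (Fin (r + 1) → Fin m → Bool) → ℝ) :
    ∑ x, F x = ∑ x₀ : Fin m → Bool, ∑ x : Fin r → Fin m → Bool,
      F (Fin.cons (α := fun _ => Fin m → Bool) x₀ x) := by
  rw [← (Fin.consEquiv fun _ : Fin (r + 1) => Fin m → Bool).sum_comp, Fintype.sum_prod_type]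
  rfl

lemma sum_ite_origin_mul (F : (Fin m → Bool) → ℝ) :
    ∑ x, (if x = fun _ => false then 1 else 0) * F x = F fun _ => false := by
  simp

/-- The good and the bad part of the kernel together annihilate all characters that have low
degree in each block. -/
lemma sum_good_add_bad_mul_walsh {ψ : (Fin m → Bool) → ℝ} {N : ℕ}
    (h0 : ψ (fun _ => false) = 1) (hψ : ∀ S, weight S ≤ N → walshCoeff ψ S = 0) (r : ℕ)
    (S : Fin r → Fin m → Bool) (hS : ∀ j, weight (S j) ≤ N) :
    ∑ x, (goodKernel ψ r x + badKernel ψ r x) * ∏ j, walsh (S j) (x j) = 0 := by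
  induction r with
  | zero => simp [goodKernel, badKernel]
  | succ r ih =>
    have ih' := ih (Fin.tail S) fun j => hS j.succ
    let B : ℝ := ∑ x, badKernel ψ r x * ∏ j, walsh (Fin.tail S j) (x j)
    have hx₀ : ∀ x₀ : Fin m → Bool, ∑ x : Fin r → Fin m → Bool,
        (goodKernel ψ (r + 1) (Fin.cons (α := fun _ => Fin m → Bool) x₀ x)
          + badKernel ψ (r + 1) (Fin.cons (α := fun _ => Fin m → Bool) x₀ x)) *
        ∏ j, walsh (S j) (Fin.cons (α := fun _ => Fin m → Bool) x₀ x j)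
        = (if x₀ = fun _ => false then 1 else 0) * (walsh (S 0) x₀ *
            ∑ x, (goodKernel ψ r x + badKernel ψ r x) * ∏ j, walsh (Fin.tail S j) (x j))
          - ψ x₀ * walsh (S 0) x₀ * B := by
      intro x₀
      rw [Finset.mul_sum, Finset.mul_sum, Finset.mul_sum, ← Finset.sum_sub_distrib]
      refine Finset.sum_congr rfl fun x _ => ?_
      rw [goodKernel, badKernel_succ, Fin.prod_univ_succ, eq_add_offPos_sub_offNeg h0 x₀]
      simp only [Fin.cons_zero, Fin.cons_succ, Fin.tail_cons, Fin.tail]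
      ring
    rw [sum_cons, Finset.sum_congr rfl fun x₀ _ => hx₀ x₀, Finset.sum_sub_distrib,
      sum_ite_origin_mul, ih', ← Finset.sum_mul]
    have := hψ (S 0) (hS 0)
    rw [walshCoeff] at this
    rw [this]
    ring

lemma sum_abs_badKernel_le {ψ : (Fin m → Bool) → ℝ} (hpos : ∑ x, offPos ψ x ≤ 1 / 2) (r : ℕ) :
    ∑ x, |badKernel ψ r x| ≤ (1 / 2) ^ r := by
  have h : ∀ x : Fin r → Fin m → Bool, |badKernel ψ r x| = ∏ j, offPos ψ (x j) := by
    intro x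
    rw [badKernel, abs_mul, abs_neg, abs_pow, abs_neg, abs_one, one_pow, one_mul,
      abs_of_nonneg (Finset.prod_nonneg fun j _ => offPos_nonneg ψ _)]
  simp only [h]
  rw [sum_prod_eq_prod_sum fun _ : Fin r => offPos ψ, Finset.prod_const, Finset.card_univ,
    Fintype.card_fin]
  gcongr
  exact Finset.sum_nonneg fun x _ => offPos_nonneg ψ x

lemma sum_abs_goodKernel_succ (ψ : (Fin m → Bool) → ℝ) (r : ℕ) :
    ∑ x, |goodKernel ψ (r + 1) x|
      = ∑ x, |goodKernel ψ r x| + (∑ x, offNeg ψ x) * ∑ x, |badKernel ψ r x| := by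
  have h : ∀ (x₀ : Fin m → Bool) (x : Fin r → Fin m → Bool),
      |goodKernel ψ (r + 1) (Fin.cons (α := fun _ => Fin m → Bool) x₀ x)|
      = (if x₀ = fun _ => false then 1 else 0) * |goodKernel ψ r x|
        + offNeg ψ x₀ * |badKernel ψ r x| := by
    intro x₀ x
    rw [goodKernel]
    simp only [Fin.cons_zero, Fin.tail_cons]
    split_ifs with hx
    · simp [offNeg, hx]
    · rw [zero_mul, zero_mul, zero_add, zero_add, abs_mul, abs_of_nonneg (offNeg_nonneg ψ x₀)]
  rw [sum_cons]
  simp only [h, Finset.sum_add_distrib, ← Finset.mul_sum]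
  rw [sum_ite_origin_mul fun _ => ∑ x, |goodKernel ψ r x|, Finset.sum_mul]

lemma one_le_sum_abs_goodKernel (ψ : (Fin m → Bool) → ℝ) (r : ℕ) :
    1 ≤ ∑ x, |goodKernel ψ r x| := by
  induction r with
  | zero => simp [goodKernel]
  | succ r ih =>
    rw [sum_abs_goodKernel_succ]
    exact le_add_of_le_of_nonneg ih (mul_nonneg (Finset.sum_nonneg fun x _ => offNeg_nonneg ψ x)
      (Finset.sum_nonneg fun x _ => abs_nonneg _))

lemma sum_abs_goodKernel_le {ψ : (Fin m → Bool) → ℝ} (hpos : ∑ x, offPos ψ x ≤ 1 / 2)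
    (hneg : ∑ x, offNeg ψ x ≤ 3 / 2) (r : ℕ) :
    ∑ x, |goodKernel ψ r x| ≤ 4 - 3 * (1 / 2) ^ r := by
  induction r with
  | zero => simp [goodKernel]; norm_num
  | succ r ih =>
    have h1 := mul_le_mul hneg (sum_abs_badKernel_le hpos r)
      (Finset.sum_nonneg fun x _ => abs_nonneg _) (by norm_num)
    rw [sum_abs_goodKernel_succ, pow_succ]
    linarith

end Blocks

/-! ### Decision lists with small discrepancy -/

/-- A block of items with a common value `v` is passed if all its conditions fail. -/
lemma evalDecisionList_map_append {d : ℕ} {ι : Type*} (l : List ι) (a : ι → Fin d) (b : ι → Bool)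
    (v : Bool) (L : List ((Fin d × Bool) × Bool)) (v₀ : Bool) (x : Cube d) :
    evalDecisionList (l.map (fun i => ((a i, !b i), v)) ++ L) v₀ x
      = if ∀ i ∈ l, (x (a i) ^^ b i) = false then evalDecisionList L v₀ x else v := by
  induction l with
  | nil => simp
  | cons i l ih =>
    simp only [List.map_cons, List.cons_append, evalDecisionList, ih, List.mem_cons,
      forall_eq_or_imp]
    cases x (a i) <;> cases b i <;> simp

lemma ite_mem_decisionLists {d m : ℕ} (a : Fin m → Fin d) (b : Fin m → Bool) (v : Bool)
    {g : BoolFun d} (hg : g ∈ decisionLists d) :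
    (fun x => if (fun i => x (a i) ^^ b i) = (fun _ => false) then g x else v)
      ∈ decisionLists d := by
  obtain ⟨L, v₀, rfl⟩ := hg
  refine ⟨(List.finRange m).map (fun i => ((a i, !b i), v)) ++ L, v₀, ?_⟩
  funext x
  rw [evalDecisionList_map_append]
  simp [funext_iff]

lemma not_mem_decisionLists {d : ℕ} {g : BoolFun d} (hg : g ∈ decisionLists d) :
    (fun x => !g x) ∈ decisionLists d := by
  obtain ⟨L, b, rfl⟩ := hg
  refine ⟨L.map fun p => (p.1, !p.2), !b, ?_⟩
  funext x
  induction L with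
  | nil => rfl
  | cons p L ih =>
    obtain ⟨⟨i, s⟩, v⟩ := p
    simp only [evalDecisionList, List.map_cons, ← ih]
    split_ifs <;> rfl

lemma firstBlockSign_mem_decisionLists {d m : ℕ} (r : ℕ) (a : Fin r → Fin m → Fin d)
    (b : Fin r → Fin m → Bool) :
    (fun x : Cube d => firstBlockSign r fun j i => x (a j i) ^^ b j i) ∈ decisionLists d := by
  induction r with
  | zero => exact ⟨[], true, rfl⟩
  | succ r ih =>
    exact ite_mem_decisionLists (a 0) (b 0) (decide (Odd r)) (ih (Fin.tail a) (Fin.tail b))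

/-- The good kernel as a function on the cube with coordinates `Fin r × Fin m`. -/
noncomputable def blockKernel {m : ℕ} (ψ : (Fin m → Bool) → ℝ) (r : ℕ)
    (z : Fin r × Fin m → Bool) : ℝ :=
  goodKernel ψ r fun j i => z (j, i)

lemma sum_curry {r m : ℕ} (F : (Fin r → Fin m → Bool) → ℝ) :
    ∑ z : Fin r × Fin m → Bool, F (fun j i => z (j, i)) = ∑ x, F x :=
  (Equiv.curry (Fin r) (Fin m) Bool).sum_comp F

lemma weight_block_le {r m : ℕ} (S : Fin r × Fin m → Bool) (j : Fin r) :
    weight (fun i => S (j, i)) ≤ weight S := by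
  refine Finset.card_le_card_of_injOn (fun i => (j, i)) ?_ ?_
  · intro i hi
    simpa using hi
  · intro i _ i' _ h
    exact congrArg Prod.snd h

/-- Coefficients at sets of at most `N` variables are small because they agree, up to sign, with
those of the bad part, which has mass `2 ^ (-N)`. The other ones are bounded by the mass of the
kernel and will be damped by the lift. -/
lemma walshCoeff_blockKernel_sq_le {m N : ℕ} {ψ : (Fin m → Bool) → ℝ}
    (h0 : ψ (fun _ => false) = 1)
    (hpos : ∑ x ∈ Finset.univ.erase (fun _ => false), max (ψ x) 0 ≤ 1 / 2)
    (hψ : ∀ S, weight S ≤ N → walshCoeff ψ S = 0) (S : Fin N × Fin m → Bool) :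
    walshCoeff (blockKernel ψ N) S ^ 2
      ≤ (4 * ((2 : ℝ) ^ ((1 / 2 : ℝ) * N))⁻¹) ^ 2 * 2 ^ weight S := by
  have hpos' : ∑ x, offPos ψ x ≤ 1 / 2 := by
    refine le_trans (le_of_eq ?_) hpos
    rw [← Finset.add_sum_erase _ _ (Finset.mem_univ fun _ => false)]
    rw [show offPos ψ (fun _ => false) = 0 by simp [offPos], zero_add]
    refine Finset.sum_congr rfl fun x hx => ?_
    rw [offPos, if_neg (Finset.ne_of_mem_erase hx)]
  have hneg : ∑ x, offNeg ψ x ≤ 3 / 2 := by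
    have h1 := hψ (fun _ => false) (by simp [weight])
    have h2 : ∑ x, ψ x = 0 := by simpa [walshCoeff, walsh] using h1
    simp only [eq_add_offPos_sub_offNeg h0, Finset.sum_sub_distrib, Finset.sum_add_distrib] at h2
    have h3 := sum_ite_origin_mul (m := m) fun _ => 1
    simp only [mul_one] at h3
    linarith
  have hη : (4 * ((2 : ℝ) ^ ((1 / 2 : ℝ) * N))⁻¹) ^ 2 = 16 * (1 / 2) ^ N := by
    rw [mul_pow, inv_pow, ← Real.rpow_natCast (2 ^ _), ← Real.rpow_mul (by norm_num),
      show (1 / 2 : ℝ) * N * (2 : ℕ) = N by push_cast; ring, Real.rpow_natCast, one_div, inv_pow]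
    norm_num
  have hprod : ∀ x : Fin N → Fin m → Bool, ∀ z : Fin N × Fin m → Bool,
      (fun j i => z (j, i)) = x → walsh S z = ∏ j, walsh (fun i => S (j, i)) (x j) := by
    rintro x z rfl
    rw [walsh, Fintype.prod_prod_type]
    rfl
  rw [hη]
  by_cases hS : weight S ≤ N
  · have hsum := sum_good_add_bad_mul_walsh h0 hψ N (fun j i => S (j, i))
      fun j => (weight_block_le S j).trans hS
    simp only [add_mul, Finset.sum_add_distrib] at hsum
    have hcoeff : walshCoeff (blockKernel ψ N) S
        = ∑ x, goodKernel ψ N x * ∏ j, walsh (fun i => S (j, i)) (x j) := by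
      rw [walshCoeff, ← sum_curry]
      refine Finset.sum_congr rfl fun z _ => ?_
      rw [hprod _ z rfl, blockKernel]
    have hle : |walshCoeff (blockKernel ψ N) S| ≤ (1 / 2) ^ N := by
      rw [hcoeff, eq_neg_of_add_eq_zero_left hsum, abs_neg]
      refine (Finset.abs_sum_le_sum_abs _ _).trans
        (le_trans (le_of_eq ?_) (sum_abs_badKernel_le hpos' N))
      refine Finset.sum_congr rfl fun x _ => ?_
      rw [abs_mul, Finset.abs_prod]
      simp [abs_walsh]
    have h1 : (0 : ℝ) ≤ (1 / 2) ^ N := by positivity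
    have h2 : ((1 : ℝ) / 2) ^ N ≤ 1 := pow_le_one₀ (by norm_num) (by norm_num)
    have h3 : (1 : ℝ) ≤ 2 ^ weight S := one_le_pow₀ (by norm_num)
    calc walshCoeff (blockKernel ψ N) S ^ 2 ≤ ((1 / 2) ^ N) ^ 2 := by
          rw [← sq_abs]; gcongr
      _ ≤ 16 * (1 / 2) ^ N * 1 := by nlinarith
      _ ≤ _ := by gcongr
  · have hle : |walshCoeff (blockKernel ψ N) S| ≤ 4 := by
      refine (abs_walshCoeff_le _ S).trans ?_
      have h1 := sum_abs_goodKernel_le hpos' hneg N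
      have h2 : (0 : ℝ) ≤ (1 / 2) ^ N := by positivity
      simp only [blockKernel]
      rw [sum_curry fun x => |goodKernel ψ N x|]
      linarith
    calc walshCoeff (blockKernel ψ N) S ^ 2 ≤ 4 ^ 2 := by
          rw [← sq_abs]; gcongr
      _ = 16 * (1 / 2) ^ N * 2 ^ N := by
          rw [mul_assoc, ← mul_pow]; norm_num
      _ ≤ _ := by
          gcongr
          · norm_num
          · omega

/-- The family of decision lists `firstBlockSign (x_V + w)`, where `x_V` is the selection of one of
two copies of each variable, and `w` is a translation. -/
theorem exists_decisionLists_kernel {d N : ℕ} (hd : 68 * N * (N + 1) ^ 2 ≤ d) :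
    ∃ (α : Type) (_ : Fintype α) (f : α → BoolFun d) (K : α → Cube d → ℝ),
      (∀ a, f a ∈ decisionLists d) ∧ (∀ a, (fun x => !f a x) ∈ decisionLists d) ∧
      (∀ a x, 0 ≤ boolSign (f a x) * K a x) ∧ 1 ≤ ∑ a, ∑ x, |K a x| ∧
      ∀ g : Cube d → ℝ, (∀ x, |g x| ≤ 1) →
        ∑ a, |∑ x, K a x * g x| ≤ 4 * ((2 : ℝ) ^ ((1 / 2 : ℝ) * N))⁻¹ := by
  obtain ⟨m, hm, ψ, h0, hpos, hψ⟩ : ∃ m, m = 34 * (N + 1) ^ 2 ∧ ∃ ψ : (Fin m → Bool) → ℝ,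
      ψ (fun _ => false) = 1 ∧
      ∑ x ∈ Finset.univ.erase (fun _ => false), max (ψ x) 0 ≤ 1 / 2 ∧
      ∀ S, weight S ≤ N + 1 → walshCoeff ψ S = 0 := ⟨_, rfl, exists_blockKernel (by omega)⟩
  obtain ⟨e⟩ : Nonempty ((Fin N × Fin m) × Bool ↪ Fin d) := by
    refine Function.Embedding.nonempty_of_card_le ?_
    simp only [Fintype.card_prod, Fintype.card_fin, Fintype.card_bool, hm]
    refine le_trans (le_of_eq ?_) hd
    ring
  let f : ((Fin N × Fin m → Bool) × (Fin N × Fin m → Bool)) → BoolFun d := fun a x =>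
    firstBlockSign N fun j i => x (e ((j, i), a.1 (j, i))) ^^ a.2 (j, i)
  have hf : ∀ a, f a ∈ decisionLists d := fun a =>
    firstBlockSign_mem_decisionLists N (fun j i => e ((j, i), a.1 (j, i))) fun j i => a.2 (j, i)
  refine ⟨_, inferInstance, f, liftedKernel e (blockKernel ψ N), hf,
    fun a => not_mem_decisionLists (hf a), fun a x => ?_, ?_, fun g hg => ?_⟩
  · rw [liftedKernel, mul_left_comm]
    exact mul_nonneg (by positivity) (boolSign_mul_goodKernel_nonneg ψ N _)
  · rw [sum_abs_liftedKernel]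
    simp only [blockKernel]
    rw [sum_curry fun x => |goodKernel ψ N x|]
    exact one_le_sum_abs_goodKernel ψ N
  · exact sum_abs_liftedKernel_mul_le e.injective (by positivity)
      (walshCoeff_blockKernel_sq_le h0 hpos fun S hS => hψ S (by omega)) hg

/-! ### The lower bounds on the sample size -/

/-- The hypothesis forces `n ≥ 1` and hence `n e^ε ≥ 1 + 2^(γ D) / (2 B)`, which by Bernoulli's
inequality is at least `2^(γ D / (2 B))`, with no condition that `D` is large. -/
lemma two_rpow_div_exp_le {n : ℕ} {ε B γ D : ℝ} (hB : 1 ≤ B) (hγ : 0 ≤ γ)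
    (hD : 0 ≤ D) (h : 1 / 2 ≤ n * ((Real.exp ε - 1) * (B * ((2 : ℝ) ^ (γ * D))⁻¹))) :
    (2 : ℝ) ^ (γ / (2 * B) * D) / Real.exp ε ≤ n := by
  set y : ℝ := (2 : ℝ) ^ (γ * D) with hy
  have hy1 : 1 ≤ y := Real.one_le_rpow (by norm_num) (mul_nonneg hγ hD)
  have hn : 1 ≤ (n : ℝ) := by
    rcases Nat.eq_zero_or_pos n with rfl | hn
    · norm_num at h
    · exact_mod_cast hn
  have hA0 : 0 ≤ (2 * B)⁻¹ := by positivity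
  have hbern : y ^ (2 * B)⁻¹ ≤ 1 + (2 * B)⁻¹ * (y - 1) := by
    have := rpow_one_add_le_one_add_mul_self (s := y - 1) (p := (2 * B)⁻¹) (by linarith) hA0
      (inv_le_one_of_one_le₀ (by linarith))
    rwa [add_sub_cancel] at this
  have hpow : (2 : ℝ) ^ (γ / (2 * B) * D) = y ^ (2 * B)⁻¹ := by
    rw [hy, ← Real.rpow_mul (by norm_num)]
    congr 1
    ring
  have hmain : (2 * B)⁻¹ * y ≤ n * (Real.exp ε - 1) := by
    have h2 : n * ((Real.exp ε - 1) * (B * y⁻¹)) = n * (Real.exp ε - 1) * B / y := by ring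
    rw [h2, le_div_iff₀ (by linarith)] at h
    rw [inv_mul_le_iff₀ (by positivity)]
    linarith
  rw [div_le_iff₀ (Real.exp_pos ε), hpow]
  linarith

lemma exists_block_count (d : ℕ) :
    ∃ N : ℕ, 68 * N * (N + 1) ^ 2 ≤ d ∧ (d : ℝ) ^ ((1 : ℝ) / 3) / 7 ≤ N + 1 := by
  have hD0 : 0 ≤ (d : ℝ) ^ ((1 : ℝ) / 3) := by positivity
  have hD3 : ((d : ℝ) ^ ((1 : ℝ) / 3)) ^ 3 = d := by
    rw [← Real.rpow_natCast, ← Real.rpow_mul (Nat.cast_nonneg d)]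
    norm_num
  refine ⟨⌊(d : ℝ) ^ ((1 : ℝ) / 3) / 7⌋₊, ?_, (Nat.lt_floor_add_one _).le⟩
  set N := ⌊(d : ℝ) ^ ((1 : ℝ) / 3) / 7⌋₊
  have hN : (N : ℝ) ≤ (d : ℝ) ^ ((1 : ℝ) / 3) / 7 := Nat.floor_le (by positivity)
  have h343 : 343 * N ^ 3 ≤ d := by
    have : 343 * (N : ℝ) ^ 3 ≤ (d : ℝ) := by
      calc 343 * (N : ℝ) ^ 3 ≤ 343 * ((d : ℝ) ^ ((1 : ℝ) / 3) / 7) ^ 3 := by gcongr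
        _ = (d : ℝ) := by rw [div_pow, hD3]; ring
    exact_mod_cast this
  refine le_trans ?_ h343
  rcases Nat.eq_zero_or_pos N with h0 | h0
  · simp [h0]
  · calc 68 * N * (N + 1) ^ 2 ≤ 68 * N * (2 * N) ^ 2 := by gcongr; omega
      _ = 272 * N ^ 3 := by ring
      _ ≤ 343 * N ^ 3 := by gcongr; norm_num

theorem mainTheorem4 :
    (∃ c : ℝ, 0 < c ∧ ∀ (d n : ℕ) (ε : ℝ), 0 ≤ ε →
      ∀ (Ω W : Type*) [MeasurableSpace Ω] (μ : MeasureTheory.Measure Ω)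
        [MeasureTheory.IsProbabilityMeasure μ]
        (A : Ω → Protocol n (Example d) W (BoolFun d)),
        LearnsLabelNonAdaptively ε (linearSeparators d) μ A →
          (2 : ℝ) ^ (c * (d : ℝ)) / Real.exp ε ≤ (n : ℝ)) ∧
    (∃ c : ℝ, 0 < c ∧ ∀ (d n : ℕ) (ε : ℝ), 0 ≤ ε →
      ∀ (Ω W : Type*) [MeasurableSpace Ω] (μ : MeasureTheory.Measure Ω)
        [MeasureTheory.IsProbabilityMeasure μ]
        (A : Ω → Protocol n (Example d) W (BoolFun d)),
        LearnsLabelNonAdaptively ε (decisionLists d) μ A →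
          (2 : ℝ) ^ (c * (d : ℝ) ^ ((1 : ℝ) / 3)) / Real.exp ε ≤ (n : ℝ)) := by
  refine ⟨⟨(1 / 8) / (2 * 16), by norm_num, fun d n ε hε Ω W _ μ _ A hA => ?_⟩,
    ⟨(1 / 14) / (2 * 8), by norm_num, fun d n ε hε Ω W _ μ _ A hA => ?_⟩⟩
  · obtain ⟨α, _, f, K, hf, hf', hsign, hmass, hdisc⟩ := exists_linearSeparators_kernel d
    exact two_rpow_div_exp_le (by norm_num) (by norm_num) (Nat.cast_nonneg d)
      (half_le_of_learnsLabelNonAdaptively hε hA hf hf' hsign hmass hdisc)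
  · obtain ⟨N, hNd, hN⟩ := exists_block_count d
    obtain ⟨α, _, f, K, hf, hf', hsign, hmass, hdisc⟩ := exists_decisionLists_kernel hNd
    set D : ℝ := (d : ℝ) ^ ((1 : ℝ) / 3)
    have hδ : 4 * ((2 : ℝ) ^ ((1 / 2 : ℝ) * N))⁻¹ ≤ 8 * ((2 : ℝ) ^ ((1 / 14 : ℝ) * D))⁻¹ := by
      have h1 : (2 : ℝ) ^ ((1 / 14 : ℝ) * D) ≤ 2 * (2 : ℝ) ^ ((1 / 2 : ℝ) * N) := by
        rw [← Real.rpow_one_add' (by norm_num) (by positivity)]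
        exact Real.rpow_le_rpow_of_exponent_le (by norm_num) (by linarith)
      rw [← div_eq_mul_inv, ← div_eq_mul_inv, div_le_div_iff₀ (by positivity) (by positivity)]
      linarith
    exact two_rpow_div_exp_le (by norm_num) (by norm_num) (by positivity)
      (half_le_of_learnsLabelNonAdaptively hε hA hf hf' hsign hmass fun g hg =>
        (hdisc g hg).trans hδ)
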